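/- Let $a,b,d$ be three pairwise coprime positive integers such that $d\notin\langle a,b\rangle=\{xa+yb:\ x,y\in\mathbb N\}$, where $\mathbb N=\{0,1,2,\dots\}$. Let $$S'=\frac{\langle a,b\rangle}{d}=\{x\in\mathbb N:\ dx\in\langle a,b\rangle\},$$ let $\mathrm{Irr}(S')$ be the set of positive elements of $S'$ that are not the sum of two positive elements of $S'$, and let $e(S')=\#\,\mathrm{Irr}(S')$. **Notation.** Let $m\in\{1,\dots,d-1\}$ with $am+b\equiv 0 \pmod d$, put $\alpha=m/d$, and let $\alpha=[0,a_1,\dots,a_r,1]$ be the continued fraction expansion of $\alpha$ with positive integers $a_1,\dots,a_r$ and last partial quotient $1$. Let $p_k/q_k=[0,a_1,\dots,a_k]$ be its reduced convergents ($p_0=0$, $q_0=1$), let $\delta_k=(-1)^k(q_k\alpha-p_k)$, let $\tau=\frac{am+b}{d}$, and let $\mu_i=\tau q_i-ap_i$. A sequence $(d_1,\dots,d_r)$ of non-negative integers (continued by $0$) is *$\alpha$-admissible* if for every $j\in\{1,\dots,r\}$ we have $d_j\le a_j$ and, whenever $d_j=0$, either $d_i=0$ for all $i\ge j$, or $j\ge2$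 and $d_{j-1}=a_{j-1}$. The *$\alpha$-numeration of an integer* $n\in\{0,\dots,d-1\}$ is the $\alpha$-admissible sequence with $n=\sum_{j=1}^r d_jq_{j-1}$. The *$\alpha$-numeration of a rational* $\beta\in\{0,\frac1d,\dots,\frac{d-1}{d}\}$ is the $\alpha$-admissible sequence with $\beta=\sum_{j=1}^r(-1)^{j-1}d_j\delta_{j-1}$. If $a<d$, let $(N_1,\dots,N_s)$, $N_s>0$, be the $\alpha$-numeration of $a-1$ without its final zeros, and let $$x_0=\begin{cases} d(\delta_{s-2}-N_s\delta_{s-1}) & s\text{ even}\\ d\,\delta_{s-1}& s\text{ odd}\end{cases},\qquad \nu=\begin{cases}N_s& s\text{ even}\\0& s\text{ odd}\end{cases},\qquad a'_{2k}=\begin{cases}a_{2k}& 2k<s\\ N_s& 2k=s.\end{cases}$$ **Statement.** In each of the following cases, the listed elements of $\mathrm{Irr}(S')$ are pairwise distinct. *Case 1: $d<a<b$.* Then $e(S')=3+\sum_{k=1}^{\lfloor r/2\rfloor}a_{2k}$ and $$\mathrm{Irr}(S')=\{a,\ b,\ \tau\}\cup\{\mu_{2k-2}+j\mu_{2k-1}:\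 1\le k\le\lfloor r/2\rfloor,\ 1\le j\le a_{2k}\}.$$ *Case 2: $a<d<b$, or $a<b<d$ and $x_0+b>d$.* Then $e(S')=2+\sum_{k=1}^{\lfloor (s-1)/2\rfloor}a_{2k}+\nu$ and $$\mathrm{Irr}(S')=\{a,\ \tau\}\cup\{\mu_{2k-2}+j\mu_{2k-1}:\ 1\le k\le\lfloor s/2\rfloor,\ 1\le j\le a'_{2k}\}.$$ *Case 3: $a<b<d$ and $m<x_0+b\le d$.* Then $a\notin\mathrm{Irr}(S')$, $e(S')=1+\sum_{k=1}^{\lfloor (s-1)/2\rfloor}a_{2k}+\nu$ and $$\mathrm{Irr}(S')=\{\tau\}\cup\{\mu_{2k-2}+j\mu_{2k-1}:\ 1\le k\le\lfloor s/2\rfloor,\ 1\le j\le a'_{2k}\}.$$ *Case 4: $a<b<d$ and $x_0+b\le m$.* Let $\beta=\frac{x_0+b-1}{d}$ and let $(b_1,\dots,b_{s'})$, $b_{s'}>0$, be its $\alpha$-numeration without its final zeros. Let $t=\min\{i>0:\ b_{2i+1}>0\}$ if such an $i$ exists; otherwise $s'$ is even and we let $t=s'/2$. Then $a\notin\mathrm{Irr}(S')$,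 $$\mathrm{Irr}(S')=\{\mu_{2k-2}+j\mu_{2k-1}:\ t\le k\le\lfloor s/2\rfloor,\ c_{2k}\le j\le a'_{2k}\},\qquad c_{2k}=\begin{cases}b_{2t}&k=t\\1&k\ne t,\end{cases}$$ and $$e(S')=1+a_{2t}-b_{2t}+\sum_{k=t+1}^{\lfloor (s-1)/2\rfloor}a_{2k}+\nu.$$ -/

import Mathlib

/-! ### Semigroups of natural numbers -/

/-- The quotient `S / d = {x ∈ ℕ : d x ∈ S}`. -/
def semigroupQuot (S : AddSubmonoid ℕ) (d : ℕ) : AddSubmonoid ℕ where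
  carrier := {x | d * x ∈ S}
  zero_mem' := by simp
  add_mem' := by
    intro x y hx hy
    simp only [Set.mem_ofPred_eq] at hx hy ⊢
    rw [Nat.mul_add]
    exact S.add_mem hx hy

/-- The irreducible elements of `S`: the positive elements of `S` that are not a sum of two
positive elements of `S`. -/
def semigroupIrr (S : AddSubmonoid ℕ) : Set ℕ :=
  {x | x ∈ S ∧ 0 < x ∧ ∀ y ∈ S, ∀ z ∈ S, 0 < y → 0 < z → x ≠ y + z}

/-- The embedding dimension `e(S)`, the number of irreducible elements. -/
noncomputable def embDim (S : AddSubmonoid ℕ) : ℕ := (semigroupIrr S).ncard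

/-- `Irr(S)` is the set of members of `M`, and `M` is written without repetition. -/
def IrrListedBy (S : AddSubmonoid ℕ) (M : Multiset ℤ) : Prop :=
  M.Nodup ∧ (fun x : ℕ => (x : ℤ)) '' semigroupIrr S = {x | x ∈ M}

/-! ### Continued fractions -/

/-- `cfVal A n i` is the value of the bracket `[A i, A (i+1), …, A (i+n)]`. -/
def cfVal (A : ℕ → ℕ) : ℕ → ℕ → ℚ
  | 0, i => (A i : ℚ)
  | n + 1, i => (A i : ℚ) + 1 / cfVal A n (i + 1)

/-- `[0, A 1, …, A r, 1]` is the continued fraction expansion of `α` whose last term is `1`;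
the values `A k` for `k > r + 1` play no role. -/
structure IsCFE (α : ℚ) (r : ℕ) (A : ℕ → ℕ) : Prop where
  first : A 0 = 0
  pos : ∀ i, 1 ≤ i → i ≤ r → 1 ≤ A i
  last : A (r + 1) = 1
  value : α = cfVal A (r + 1) 0

/-- Numerators of the convergents `[A 0, …, A k]`. -/
def cfP (A : ℕ → ℕ) : ℕ → ℕ
  | 0 => A 0
  | 1 => A 1 * A 0 + 1
  | k + 2 => A (k + 2) * cfP A (k + 1) + cfP A k

/-- Denominators of the convergents `[A 0, …, A k]`. -/
def cfQ (A : ℕ → ℕ) : ℕ → ℕ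
  | 0 => 1
  | 1 => A 1
  | k + 2 => A (k + 2) * cfQ A (k + 1) + cfQ A k

/-- `δ_k = (-1)^k (q_k α - p_k)`. -/
def cfDelta (α : ℚ) (A : ℕ → ℕ) (k : ℕ) : ℚ :=
  (-1) ^ k * ((cfQ A k : ℚ) * α - (cfP A k : ℚ))

/-! ### Numeration attached to a continued fraction -/

/-- `(D 1, …, D r)` is an admissible sequence for `[0, A 1, …, A r, 1]`; it is extended by `0`
outside the indices `1, …, r`. -/
structure IsAdmissible (r : ℕ) (A D : ℕ → ℕ) : Prop where
  zero : D 0 = 0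
  tail : ∀ j, r < j → D j = 0
  le : ∀ j, 1 ≤ j → j ≤ r → D j ≤ A j
  zero_imp : ∀ j, 1 ≤ j → j ≤ r → D j = 0 →
    (∀ i, j ≤ i → D i = 0) ∨ (2 ≤ j ∧ D (j - 1) = A (j - 1))

/-- `D` is the numeration of the integer `n`: `D` is admissible and
`n = ∑ D_j q_{j-1}`. -/
def IsNumerationNat (r : ℕ) (A : ℕ → ℕ) (n : ℕ) (D : ℕ → ℕ) : Prop :=
  IsAdmissible r A D ∧ ∑ j ∈ Finset.Icc 1 r, D j * cfQ A (j - 1) = n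

/-- `D` is the numeration of the rational `β`: `D` is admissible and
`β = ∑ D_j (-1)^{j-1} δ_{j-1}`. -/
def IsNumerationRat (α : ℚ) (r : ℕ) (A : ℕ → ℕ) (β : ℚ) (D : ℕ → ℕ) : Prop :=
  IsAdmissible r A D ∧
    ∑ j ∈ Finset.Icc 1 r, (D j : ℚ) * (-1) ^ (j - 1) * cfDelta α A (j - 1) = β

/-- `D s` is the last nonzero term of `D`. -/
def IsLastNonzero (D : ℕ → ℕ) (s : ℕ) : Prop :=
  0 < D s ∧ ∀ i, s < i → D i = 0

/-! ### The quantities in the description of the irreducible elements -/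

/-- `d (δ_{s-2} - N_s δ_{s-1})` if `s` is even, `d δ_{s-1}` if `s` is odd. -/
def xZero (d : ℕ) (α : ℚ) (A N : ℕ → ℕ) (s : ℕ) : ℚ :=
  if Even s then (d : ℚ) * (cfDelta α A (s - 2) - (N s : ℚ) * cfDelta α A (s - 1))
  else (d : ℚ) * cfDelta α A (s - 1)

/-- `N_s` if `s` is even, `0` if `s` is odd. -/
def nuTerm (N : ℕ → ℕ) (s : ℕ) : ℕ := if Even s then N s else 0

/-- `a'_{2k}`: equal to `a_{2k}` if `2k < s` and to `N_s` if `2k = s`. -/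
def aPrime (A N : ℕ → ℕ) (s k : ℕ) : ℕ := if 2 * k < s then A (2 * k) else N s

open Classical in
/-- The least `i > 0` with `B (2i+1) > 0` if there is one, and `s' / 2` otherwise. -/
noncomputable def tIndex (B : ℕ → ℕ) (s' : ℕ) : ℕ :=
  if ∃ i, 0 < i ∧ 0 < B (2 * i + 1) then sInf {i | 0 < i ∧ 0 < B (2 * i + 1)} else s' / 2

/-- The family of the values `μ_{2k-2} + j μ_{2k-1}` for `k₀ ≤ k ≤ k₁` and `lo k ≤ j ≤ hi k`. -/
def muFamily (μ : ℕ → ℤ) (k₀ k₁ : ℕ) (lo hi : ℕ → ℕ) : Multiset ℤ :=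
  (Finset.Icc k₀ k₁).val.bind fun k =>
    (Finset.Icc (lo k) (hi k)).val.map fun j => μ (2 * k - 2) + (j : ℤ) * μ (2 * k - 1)

/-! Since `b ≡ -a m` mod `d` and `a` is invertible mod `d`, `d` divides `a u + b v` exactly when `u
≡ m v` mod `d`. So the quotient is the image of the lattice points `u ≡ m v` of the quadrant under
`(u, v) ↦ (a u + b v) / d`, and two points have the same image exactly when they differ by a
multiple of `(b, -a)`; normalise by `v < a`. A normalised point other than `(d, 0)` can be
irreducible only if no earlier point has residue at most `u`: then `u = m v mod d` and `v` is a
record. It must also survive the passage to `(u - b, v + a)`. If `x₀` is the least residue `m w mod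
d` over `1 ≤ w < a`, this second point splits off the point attaining `x₀` as soon as `u ≥ x₀ + b`,
and conversely any decomposition of it forces `u ≥ x₀ + b`. Hence `semigroupIrr_quot_eq`: the
irreducibles are the values at records `v < a` of residue below `x₀ + b`, together with `a`, the
value at `(d, 0)`, when `d < x₀ + b`. Comparing `x₀ + b` with `d` and with `m`, the residue at `v =
1`, produces the cases. The records are the one-sided best approximations of `α`: `1` and the
intermediate denominators `q_{2K} + j q_{2K+1}`, of residue `d (δ_{2K} - j δ_{2K+1})` (with `d`
itself as the final record). Consecutive ones form a lattice basis of determinant `d`, so no point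
lies below them (`le_of_lattice_gap`, `IsCFE.stepErr_le_res`). The numeration of `a - 1` places `a`
among the intermediate denominators, which gives `x₀` and the records below `a`
(`IsNumerationNat.exists_min_res`, `IsNumerationNat.isResRecord_lt_iff`). The numeration of `β`
places `x₀ + b - 1` among the residues (`IsAdmissible.tIndex_spec`). In Case 4 the assumption `d ∉
⟨a, b⟩` keeps the segment found by `β` strictly before the one where `a - 1` ends
(`IsNumerationNat.segment_lt`): otherwise determinants write `d` explicitly as a combination of `a`
and `b`. -/

/-! ### Irreducible elements of `⟨a, b⟩ / d` -/

/-- `v` is a strict record minimum of `w ↦ m w mod d` on the positive integers. -/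
def IsResRecord (m d v : ℕ) : Prop :=
  1 ≤ v ∧ ∀ w, 1 ≤ w → w < v → m * v % d < m * w % d

/-- The element of `⟨a, b⟩ / d` represented by `(m v mod d, v)`. -/
def resVal (a b d m v : ℕ) : ℕ := (a * (m * v % d) + b * v) / d

theorem mem_semigroupQuot_pair {a b d x : ℕ} :
    x ∈ semigroupQuot (AddSubmonoid.closure ({a, b} : Set ℕ)) d ↔
      ∃ u v, d * x = a * u + b * v := by
  change d * x ∈ AddSubmonoid.closure ({a, b} : Set ℕ) ↔ _
  rw [AddSubmonoid.mem_closure_pair]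
  constructor
  · rintro ⟨u, v, h⟩
    exact ⟨u, v, by rw [← h]; simp [mul_comm]⟩
  · rintro ⟨u, v, h⟩
    exact ⟨u, v, by rw [h]; simp [mul_comm]⟩

theorem exists_rep_lt {a b d x : ℕ} (ha : 0 < a)
    (hx : x ∈ semigroupQuot (AddSubmonoid.closure ({a, b} : Set ℕ)) d) :
    ∃ u v, d * x = a * u + b * v ∧ v < a := by
  obtain ⟨u, v, h⟩ := mem_semigroupQuot_pair.1 hx
  refine ⟨u + b * (v / a), v % a, ?_, Nat.mod_lt _ ha⟩
  rw [h]
  conv_lhs => rw [← Nat.div_add_mod v a]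
  ring

theorem modEq_of_dvd_combination {a b d m u v : ℕ} (had : Nat.Coprime a d)
    (hm : d ∣ a * m + b) (h : d ∣ a * u + b * v) : u ≡ m * v [MOD d] := by
  have h1 : a * u ≡ a * (m * v) [MOD d] := by
    have h2 : a * u + b * v ≡ a * (m * v) + b * v [MOD d] := by
      have h3 : a * (m * v) + b * v = (a * m + b) * v := by ring
      rw [h3]
      exact ((Nat.modEq_zero_iff_dvd).2 h).trans
        ((Nat.modEq_zero_iff_dvd).2 (hm.mul_right v)).symm
    exact Nat.ModEq.add_right_cancel' _ h2
  exact Nat.ModEq.cancel_left_of_coprime (by rw [Nat.gcd_comm]; exact had) h1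

theorem dvd_combination_of_modEq {a b d m u v : ℕ}
    (hm : d ∣ a * m + b) (h : u ≡ m * v [MOD d]) : d ∣ a * u + b * v := by
  have h1 : a * u + b * v ≡ a * (m * v) + b * v [MOD d] := (h.mul_left a).add_right _
  have h3 : a * (m * v) + b * v = (a * m + b) * v := by ring
  rw [h3] at h1
  exact (Nat.modEq_zero_iff_dvd).1 (h1.trans ((Nat.modEq_zero_iff_dvd).2 (hm.mul_right v)))

theorem mul_resVal {a b d m : ℕ} (hm : d ∣ a * m + b) (v : ℕ) :
    d * resVal a b d m v = a * (m * v % d) + b * v :=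
  Nat.mul_div_cancel' (dvd_combination_of_modEq hm (Nat.mod_modEq _ _))

theorem res_le_of_dvd {a b d m u v : ℕ} (had : Nat.Coprime a d)
    (hm : d ∣ a * m + b) (h : d ∣ a * u + b * v) : m * v % d ≤ u := by
  have := modEq_of_dvd_combination had hm h
  rw [← this]
  exact Nat.mod_le _ _

theorem resVal_mem {a b d m : ℕ} (hm : d ∣ a * m + b) (v : ℕ) :
    resVal a b d m v ∈ semigroupQuot (AddSubmonoid.closure ({a, b} : Set ℕ)) d :=
  mem_semigroupQuot_pair.2 ⟨_, _, mul_resVal hm v⟩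

theorem resVal_pos {a b d m : ℕ} (hb : 0 < b) (hm : d ∣ a * m + b) {v : ℕ} (hv : 1 ≤ v) :
    0 < resVal a b d m v := by
  have h := mul_resVal hm v
  rcases Nat.eq_zero_or_pos (resVal a b d m v) with h0 | h0
  · rw [h0] at h
    have : 0 < b * v := by positivity
    omega
  · exact h0

/-- Modulo `a` the value determines `b v`, hence `v`. -/
theorem resVal_injOn {a b d m v w : ℕ} (hab : Nat.Coprime a b)
    (hm : d ∣ a * m + b) (hv : v < a) (hw : w < a)
    (h : resVal a b d m v = resVal a b d m w) : v = w := by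
  have h1 := mul_resVal hm v
  have h2 := mul_resVal hm w
  rw [h, h2] at h1
  have h3 : b * w ≡ b * v [MOD a] := by
    have h4 : a * (m * w % d) + b * w ≡ a * (m * v % d) + b * v [MOD a] := by rw [h1]
    simpa [Nat.ModEq, Nat.mul_add_mod] using h4
  have h5 := Nat.ModEq.cancel_left_of_coprime hab h3
  exact (Nat.ModEq.eq_of_lt_of_lt h5 hw hv).symm

/-- An element of the quotient that splits off the value of another pair is reducible. -/
theorem not_mem_irr_of_split {a b d m u v w U V x : ℕ} (hb : 0 < b) (hd : 0 < d)
    (hm : d ∣ a * m + b) (hx : d * x = a * u + b * v) (hV : 1 ≤ V) (hU : m * V % d = U)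
    (hUu : u = U + w) {z : ℕ} (hz : 1 ≤ z) (hv : v = V + z) :
    x ∉ semigroupIrr (semigroupQuot (AddSubmonoid.closure ({a, b} : Set ℕ)) d) := by
  rintro ⟨-, -, hirr⟩
  have h1 := mul_resVal hm V
  have h2 : d ∣ a * w + b * z := by
    have : d * x = d * resVal a b d m V + (a * w + b * z) := by
      rw [hx, h1, hUu, hv, hU]; ring
    exact (Nat.dvd_add_right (dvd_mul_right d _)).1 (this ▸ dvd_mul_right d x)
  obtain ⟨y, hy⟩ := h2
  refine hirr _ (resVal_mem hm V) y (mem_semigroupQuot_pair.2 ⟨w, z, hy.symm⟩)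
    (resVal_pos hb hm hV) ?_ ?_
  · rcases Nat.eq_zero_or_pos y with h0 | h0
    · have : 0 < b * z := by positivity
      rw [h0] at hy; omega
    · exact h0
  · apply Nat.eq_of_mul_eq_mul_left hd
    rw [mul_add, h1, ← hy, hx, hUu, hv, hU]; ring

theorem add_eq_or_eq_add_of_modEq {a v v₁ v₂ : ℕ} (h₁ : v₁ < a) (h₂ : v₂ < a) (hv : v < a)
    (h : v ≡ v₁ + v₂ [MOD a]) : v₁ + v₂ = v ∨ v₁ + v₂ = v + a := by
  unfold Nat.ModEq at h
  rw [Nat.mod_eq_of_lt hv] at h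
  rcases lt_or_ge (v₁ + v₂) a with h3 | h3
  · left; rw [h, Nat.mod_eq_of_lt h3]
  · right
    rw [Nat.mod_eq_sub_mod h3, Nat.mod_eq_of_lt (by omega)] at h
    omega

/-- The irreducible elements of `⟨a, b⟩ / d` in terms of the records of `v ↦ m v mod d`. -/
theorem semigroupIrr_quot_eq {a b d m V x₀ : ℕ} (hb : 0 < b) (hd : 0 < d)
    (hab : Nat.Coprime a b) (had : Nat.Coprime a d) (hm : d ∣ a * m + b)
    (hV : 1 ≤ V) (hVa : V < a) (hx₀ : m * V % d = x₀)
    (hmin : ∀ w, 1 ≤ w → w < a → x₀ ≤ m * w % d) :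
    semigroupIrr (semigroupQuot (AddSubmonoid.closure ({a, b} : Set ℕ)) d) =
      {x | (x = a ∧ d < x₀ + b) ∨
        ∃ v, IsResRecord m d v ∧ v < a ∧ m * v % d < x₀ + b ∧ x = resVal a b d m v} := by
  have ha : 0 < a := by omega
  ext x
  constructor
  · intro hx
    obtain ⟨u, v, hxuv, hva⟩ := exists_rep_lt ha hx.1
    have hmod := modEq_of_dvd_combination had hm (hxuv ▸ dvd_mul_right d x)
    have hamem : a ∈ semigroupQuot (AddSubmonoid.closure ({a, b} : Set ℕ)) d :=
      mem_semigroupQuot_pair.2 ⟨d, 0, by ring⟩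
    -- A point with `u ≥ d` other than `(d, 0)` splits off `(d, 0)`, which represents `a`.
    have hud : u < d ∨ (u = d ∧ v = 0) := by
      by_contra! hcon
      obtain ⟨w, rfl⟩ := Nat.exists_eq_add_of_le hcon.1
      have h2 : d ∣ a * w + b * v := by
        have h3 : d * x = d * a + (a * w + b * v) := by rw [hxuv]; ring
        exact (Nat.dvd_add_right (dvd_mul_right d _)).1 (h3 ▸ dvd_mul_right d x)
      obtain ⟨y, hy⟩ := h2
      refine hx.2.2 a hamem y (mem_semigroupQuot_pair.2 ⟨w, v, hy.symm⟩) ha ?_ ?_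
      · rcases Nat.eq_zero_or_pos y with h0 | h0
        · exfalso
          rw [h0, mul_zero] at hy
          have hw : w = 0 := by
            rcases Nat.eq_zero_or_pos w with h | h
            · exact h
            · have : 0 < a * w := by positivity
              omega
          have hv : v = 0 := by
            rcases Nat.eq_zero_or_pos v with h | h
            · exact h
            · have : 0 < b * v := by positivity
              omega
          exact hcon.2 (by omega) hv
        · exact h0
      · apply Nat.eq_of_mul_eq_mul_left hd
        rw [mul_add, ← hy, hxuv]; ring
    rcases hud with hud | ⟨rfl, rfl⟩
    · right
      have hv1 : 1 ≤ v := by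
        rcases Nat.eq_zero_or_pos v with h | h
        · exfalso
          subst h
          have h0 : u = 0 := by
            have := hmod
            simp only [mul_zero] at this
            exact Nat.eq_zero_of_dvd_of_lt ((Nat.modEq_zero_iff_dvd).1 this) hud
          subst h0
          simp only [mul_zero, add_zero] at hxuv
          rcases Nat.mul_eq_zero.1 hxuv with h | h
          · omega
          · exact absurd hx.2.1 (by omega)
        · exact h
      have hures : m * v % d = u := by
        rw [← hmod]; exact Nat.mod_eq_of_lt hud
      have hrec : IsResRecord m d v := by
        refine ⟨hv1, fun w hw hwv => ?_⟩
        by_contra! hcon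
        exact not_mem_irr_of_split (w := u - m * w % d) (z := v - w) hb hd hm hxuv hw rfl
          (by omega) (by omega) (by omega) hx
      refine ⟨v, hrec, hva, ?_, ?_⟩
      -- If `u ≥ x₀ + b`, the other representation `(u - b, v + a)` dominates the minimal point
      -- `(x₀, V)` and splits it off.
      · by_contra! hcon
        have hVv : v < V := by
          rcases lt_trichotomy v V with h | rfl | h
          · exact h
          · omega
          · have := hrec.2 V hV h
            have := hmin v hv1 hva
            omega
        have hx2 : d * x = a * (u - b) + b * (v + a) := by
          obtain ⟨w, rfl⟩ := Nat.exists_eq_add_of_le (show b ≤ u by omega)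
          rw [hxuv, Nat.add_sub_cancel_left]; ring
        exact not_mem_irr_of_split (w := u - b - x₀) (z := v + a - V) hb hd hm hx2 hV hx₀
          (by omega) (by omega) (by omega) hx
      · apply Nat.eq_of_mul_eq_mul_left hd
        rw [mul_resVal hm, hxuv, hures]
    · left
      have hxa : x = a := by
        apply Nat.eq_of_mul_eq_mul_left hd
        rw [hxuv]; ring
      refine ⟨hxa, ?_⟩
      by_contra! hcon
      have hx2 : u * x = a * (u - b) + b * a := by
        obtain ⟨w, rfl⟩ := Nat.exists_eq_add_of_le (show b ≤ u by omega)
        rw [hxuv, Nat.add_sub_cancel_left]; ring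
      exact not_mem_irr_of_split (w := u - b - x₀) (z := a - V) hb hd hm hx2 hV hx₀
          (by omega) (by omega) (by omega) hx
  · have key : ∀ y u v, d * y = a * u + b * v → v = 0 → 0 < y → d ≤ u := by
      intro y u v hy hv hpos
      have h := modEq_of_dvd_combination had hm (hy ▸ dvd_mul_right d y)
      rw [hv, mul_zero] at h
      refine Nat.le_of_dvd ?_ ((Nat.modEq_zero_iff_dvd).1 h)
      rcases Nat.eq_zero_or_pos u with h0 | h0
      · exfalso
        rw [h0, hv] at hy
        have : 0 < d * y := by positivity
        omega
      · exact h0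
    have bound : ∀ y u v, d * y = a * u + b * v → 1 ≤ v → v < a → x₀ ≤ u := by
      intro y u v hy hv hva
      exact (hmin v hv hva).trans (res_le_of_dvd had hm (hy ▸ dvd_mul_right d y))
    -- Normalised representations of two summands add up either to `(u, v)` or to its translate `(u
    -- - b, v + a)`. Records exclude the first possibility and the bound by `x₀` the second.
    have split : ∀ y z u v, y ∈ semigroupQuot (AddSubmonoid.closure ({a, b} : Set ℕ)) d →
        z ∈ semigroupQuot (AddSubmonoid.closure ({a, b} : Set ℕ)) d →
        v < a → d * (y + z) = a * u + b * v → ∃ u₁ v₁ u₂ v₂,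
          d * y = a * u₁ + b * v₁ ∧ d * z = a * u₂ + b * v₂ ∧ v₁ < a ∧ v₂ < a ∧
          ((v₁ + v₂ = v ∧ u₁ + u₂ = u) ∨ (v₁ + v₂ = v + a ∧ u₁ + u₂ + b = u)) := by
      intro y z u v hy hz hva huv
      obtain ⟨u₁, v₁, h₁, hv₁⟩ := exists_rep_lt ha hy
      obtain ⟨u₂, v₂, h₂, hv₂⟩ := exists_rep_lt ha hz
      refine ⟨u₁, v₁, u₂, v₂, h₁, h₂, hv₁, hv₂, ?_⟩
      have hsum : a * (u₁ + u₂) + b * (v₁ + v₂) = a * u + b * v := by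
        rw [← huv, mul_add d, h₁, h₂]; ring
      have hmodb : b * v ≡ b * (v₁ + v₂) [MOD a] := by
        have h4 : a * u + b * v ≡ a * (u₁ + u₂) + b * (v₁ + v₂) [MOD a] := by rw [hsum]
        simpa [Nat.ModEq, Nat.mul_add_mod] using h4
      rcases add_eq_or_eq_add_of_modEq hv₁ hv₂ hva
        (Nat.ModEq.cancel_left_of_coprime hab hmodb) with h | h
      · refine Or.inl ⟨h, ?_⟩
        rw [h] at hsum
        exact Nat.eq_of_mul_eq_mul_left ha (Nat.add_right_cancel hsum)
      · refine Or.inr ⟨h, ?_⟩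
        rw [h] at hsum
        have h5 : a * (u₁ + u₂ + b) + b * v = a * u + b * v := by rw [← hsum]; ring
        exact Nat.eq_of_mul_eq_mul_left ha (Nat.add_right_cancel h5)
    rintro (⟨rfl, hlt⟩ | ⟨v, hrec, hva, hlt, rfl⟩)
    · refine ⟨mem_semigroupQuot_pair.2 ⟨d, 0, by ring⟩, ha, ?_⟩
      intro y hy z hz hy0 hz0 hxyz
      obtain ⟨u₁, v₁, u₂, v₂, h₁, h₂, hv₁, hv₂, h⟩ :=
        split y z d 0 hy hz ha (by rw [← hxyz]; ring)
      rcases h with ⟨hv, hu⟩ | ⟨hv, hu⟩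
      · have := key y u₁ v₁ h₁ (by omega) hy0
        have := key z u₂ v₂ h₂ (by omega) hz0
        omega
      · have := bound y u₁ v₁ h₁ (by omega) hv₁
        omega
    · refine ⟨resVal_mem hm v, resVal_pos hb hm hrec.1, ?_⟩
      intro y hy z hz hy0 hz0 hxyz
      obtain ⟨u₁, v₁, u₂, v₂, h₁, h₂, hv₁, hv₂, h⟩ :=
        split y z (m * v % d) v hy hz hva (by rw [← hxyz, mul_resVal hm])
      have hres : m * v % d < d := Nat.mod_lt _ hd
      rcases h with ⟨hv, hu⟩ | ⟨hv, hu⟩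
      · have hv1 : v₁ ≠ 0 := fun h0 => by
          have := key y u₁ v₁ h₁ h0 hy0
          omega
        have hv2 : v₂ ≠ 0 := fun h0 => by
          have := key z u₂ v₂ h₂ h0 hz0
          omega
        have h6 := hrec.2 v₁ (by omega) (by omega)
        have h7 := res_le_of_dvd had hm (h₁ ▸ dvd_mul_right d y)
        omega
      · have := bound y u₁ v₁ h₁ (by omega) hv₁
        omega

/-! ### Convergents and one-sided best approximations -/

/-- `d δ_i` for `α = m / d`, as an integer. -/
def cfErr (m d : ℕ) (A : ℕ → ℕ) (i : ℕ) : ℤ :=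
  (-1) ^ i * ((cfQ A i : ℤ) * m - (cfP A i : ℤ) * d)

/-- The denominator `q_{2K} + j q_{2K+1}` of an intermediate fraction. -/
def stepDen (A : ℕ → ℕ) (K j : ℕ) : ℕ := cfQ A (2 * K) + j * cfQ A (2 * K + 1)

/-- The residue `d (δ_{2K} - j δ_{2K+1})` of `m` times an intermediate denominator. -/
def stepErr (m d : ℕ) (A : ℕ → ℕ) (K j : ℕ) : ℤ :=
  cfErr m d A (2 * K) - j * cfErr m d A (2 * K + 1)

theorem cfErr_zero {m d : ℕ} {A : ℕ → ℕ} (h : A 0 = 0) : cfErr m d A 0 = m := by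
  simp [cfErr, cfQ, cfP, h]

theorem cfErr_one {m d : ℕ} {A : ℕ → ℕ} (h : A 0 = 0) :
    cfErr m d A 1 = d - A 1 * m := by
  simp [cfErr, cfQ, cfP, h]

theorem cfErr_add_two (m d : ℕ) (A : ℕ → ℕ) (i : ℕ) :
    cfErr m d A (i + 2) = cfErr m d A i - A (i + 2) * cfErr m d A (i + 1) := by
  simp only [cfErr, cfQ, cfP]
  push_cast
  ring

theorem cast_cfErr {m d : ℕ} (hd : 0 < d) {α : ℚ} (hα : α = (m : ℚ) / d) (A : ℕ → ℕ) (i : ℕ) :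
    (cfErr m d A i : ℚ) = d * cfDelta α A i := by
  have : (d : ℚ) ≠ 0 := by positivity
  simp only [cfErr, cfDelta, hα]
  push_cast
  field_simp

/-- This determinant is invariant under the recursion. Its value `d` makes the vectors of two
consecutive convergents a basis of the lattice `u ≡ m v` mod `d`. -/
theorem cfQ_mul_cfErr {m d : ℕ} {A : ℕ → ℕ} (h : A 0 = 0) (i : ℕ) :
    (cfQ A (i + 1) : ℤ) * cfErr m d A i + cfQ A i * cfErr m d A (i + 1) = d := by
  induction i with
  | zero => rw [cfErr_zero h, cfErr_one h]; simp [cfQ]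
  | succ i ih =>
    rw [cfErr_add_two, show cfQ A (i + 1 + 1) = A (i + 2) * cfQ A (i + 1) + cfQ A i from rfl]
    push_cast
    linear_combination ih

section Expansion

variable {m d r : ℕ} {A : ℕ → ℕ} {α : ℚ}

theorem IsCFE.one_le (hA : IsCFE α r A) {i : ℕ} (h1 : 1 ≤ i) (h2 : i ≤ r + 1) : 1 ≤ A i := by
  rcases Nat.lt_or_ge r i with h | h
  · obtain rfl : i = r + 1 := by omega
    exact hA.last.ge
  · exact hA.pos i h1 h

theorem IsCFE.cfVal_pos (hA : IsCFE α r A) (n : ℕ) :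
    ∀ i, 1 ≤ i → n + i = r + 1 → 0 < cfVal A n i := by
  induction n with
  | zero =>
    intro i h1 h2
    have := hA.one_le h1 (by omega)
    simp only [cfVal]
    exact_mod_cast this
  | succ n ih =>
    intro i h1 h2
    have := ih (i + 1) (by omega) (by omega)
    simp only [cfVal]
    positivity

theorem IsCFE.one_le_length (hA : IsCFE α r A) (hα : α = (m : ℚ) / d) (hmd : m < d) :
    1 ≤ r := by
  rcases Nat.eq_zero_or_pos r with rfl | h
  · exfalso
    have h1 := hA.value
    have h2 := hA.last
    simp only [cfVal, hA.first, zero_add] at h1 h2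
    rw [h2, hα, div_eq_iff (by positivity [show 0 < d by omega])] at h1
    norm_num at h1
    omega
  · exact h

/-- The ratio of consecutive errors is a complete quotient of the expansion; complete quotients are
positive, so positivity passes from one error to the next. -/
theorem IsCFE.cfErr_step (hA : IsCFE α r A) (hα : α = (m : ℚ) / d) (hm : 1 ≤ m) (hmd : m < d)
    (k : ℕ) : ∀ n, n + 1 + k = r → 0 < cfErr m d A k ∧
      (cfErr m d A k : ℚ) = cfVal A n (k + 2) * cfErr m d A (k + 1) := by
  induction k with
  | zero =>
    intro n hn
    have hx := hA.cfVal_pos n 2 (by omega) (by omega)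
    have hv := hA.value
    have hd : (0 : ℚ) < d := by exact_mod_cast (by omega : 0 < d)
    have hm' : (0 : ℚ) < m := by exact_mod_cast hm
    rw [show r + 1 = n + 1 + 1 by omega] at hv
    simp only [cfVal, hA.first, hα, zero_add] at hv
    rw [cfErr_zero hA.first, cfErr_one hA.first]
    refine ⟨by exact_mod_cast hm, ?_⟩
    push_cast
    norm_num at hv ⊢
    field_simp at hv
    linear_combination hv
  | succ k ih =>
    intro n hn
    obtain ⟨h1, h2⟩ := ih (n + 1) (by omega)
    have hx := hA.cfVal_pos (n + 1) (k + 2) (by omega) (by omega)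
    have hx' := hA.cfVal_pos n (k + 3) (by omega) (by omega)
    have h3 : (0 : ℚ) < cfErr m d A (k + 1) := by
      have : (0 : ℚ) < cfErr m d A k := by exact_mod_cast h1
      rw [h2] at this
      exact (pos_iff_pos_of_mul_pos this).1 hx
    refine ⟨by exact_mod_cast h3, ?_⟩
    rw [show k + 1 + 1 = k + 2 from rfl, cfErr_add_two]
    push_cast
    rw [h2]
    simp only [cfVal]
    rw [show k + 2 + 1 = k + 3 from rfl, show k + 1 + 2 = k + 3 from rfl]
    field_simp
    ring

theorem IsCFE.cfErr_pos (hA : IsCFE α r A) (hα : α = (m : ℚ) / d) (hm : 1 ≤ m) (hmd : m < d)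
    {k : ℕ} (hk : k ≤ r) : 0 < cfErr m d A k := by
  have hr := hA.one_le_length hα hmd
  rcases Nat.lt_or_ge k r with h | h
  · exact (hA.cfErr_step hα hm hmd k (r - 1 - k) (by omega)).1
  · obtain rfl : k = r := by omega
    obtain ⟨n, rfl⟩ : ∃ n, k = n + 1 := ⟨k - 1, by omega⟩
    obtain ⟨h1, h2⟩ := hA.cfErr_step hα hm hmd n 0 (by omega)
    simp only [cfVal] at h2
    rw [hA.last] at h2
    norm_num at h2
    exact_mod_cast h2 ▸ h1

theorem IsCFE.cfErr_last (hA : IsCFE α r A) (hα : α = (m : ℚ) / d) (hm : 1 ≤ m) (hmd : m < d) :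
    cfErr m d A (r + 1) = 0 := by
  have hr := hA.one_le_length hα hmd
  obtain ⟨n, rfl⟩ : ∃ n, r = n + 1 := ⟨r - 1, by omega⟩
  obtain ⟨h1, h2⟩ := hA.cfErr_step hα hm hmd n 0 (by omega)
  have h3 := hA.last
  simp only [cfVal] at h2
  rw [h3] at h2
  norm_num at h2
  rw [show n + 1 + 1 = n + 2 from rfl] at h3 ⊢
  rw [cfErr_add_two, h3, h2]
  simp

theorem IsCFE.cfErr_nonneg (hA : IsCFE α r A) (hα : α = (m : ℚ) / d) (hm : 1 ≤ m) (hmd : m < d)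
    {k : ℕ} (hk : k ≤ r + 1) : 0 ≤ cfErr m d A k := by
  rcases Nat.lt_or_ge r k with h | h
  · obtain rfl : k = r + 1 := by omega
    exact (hA.cfErr_last hα hm hmd).ge
  · exact (hA.cfErr_pos hα hm hmd h).le

theorem IsCFE.mul_cfErr_le (hA : IsCFE α r A) (hα : α = (m : ℚ) / d) (hm : 1 ≤ m)
    (hmd : m < d) {k j : ℕ} (hk : k + 2 ≤ r + 1) (hj : j ≤ A (k + 2)) :
    j * cfErr m d A (k + 1) ≤ cfErr m d A k := by
  have h1 := cfErr_add_two m d A k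
  have h2 := hA.cfErr_nonneg hα hm hmd hk
  have h3 := hA.cfErr_nonneg hα hm hmd (show k + 1 ≤ r + 1 by omega)
  have h4 : (j : ℤ) ≤ A (k + 2) := by exact_mod_cast hj
  nlinarith

theorem IsCFE.cfErr_succ_le (hA : IsCFE α r A) (hα : α = (m : ℚ) / d) (hm : 1 ≤ m)
    (hmd : m < d) {k : ℕ} (hk : k ≤ r) : cfErr m d A (k + 1) ≤ cfErr m d A k := by
  rcases Nat.lt_or_ge k r with h | h
  · have := hA.mul_cfErr_le hα hm hmd (j := 1) (show k + 2 ≤ r + 1 by omega)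
      (hA.one_le (by omega) (by omega))
    simpa using this
  · obtain rfl : k = r := by omega
    rw [hA.cfErr_last hα hm hmd]
    exact hA.cfErr_nonneg hα hm hmd (by omega)

theorem IsCFE.cfErr_antitone (hA : IsCFE α r A) (hα : α = (m : ℚ) / d) (hm : 1 ≤ m)
    (hmd : m < d) {i k : ℕ} (hik : i ≤ k) (hk : k ≤ r + 1) :
    cfErr m d A k ≤ cfErr m d A i := by
  induction k, hik using Nat.le_induction with
  | base => exact le_rfl
  | succ k _ ih =>
    exact (hA.cfErr_succ_le hα hm hmd (by omega)).trans (ih (by omega))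

theorem IsCFE.cfErr_le (hA : IsCFE α r A) (hα : α = (m : ℚ) / d) (hm : 1 ≤ m)
    (hmd : m < d) {k : ℕ} (hk : k ≤ r + 1) : cfErr m d A k ≤ m := by
  rw [← cfErr_zero (m := m) (d := d) hA.first]
  exact hA.cfErr_antitone hα hm hmd (by omega) hk

/-- Effect of the final partial quotient `1`. When `r` is even it allows one intermediate step
beyond `A r`, with residue `0`. -/
theorem IsCFE.cfErr_prev_last (hA : IsCFE α r A) (hα : α = (m : ℚ) / d) (hm : 1 ≤ m)
    (hmd : m < d) : cfErr m d A (r - 1) = cfErr m d A r := by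
  have hr := hA.one_le_length hα hmd
  obtain ⟨n, rfl⟩ : ∃ n, r = n + 1 := ⟨r - 1, by omega⟩
  have h1 := cfErr_add_two m d A n
  have h2 := hA.cfErr_last hα hm hmd
  have h3 := hA.last
  rw [show n + 1 + 1 = n + 2 from rfl] at h2 h3
  rw [h2, h3] at h1
  simp only [Nat.add_sub_cancel]
  push_cast at h1
  linarith

/-- The last nonzero error is `1`, since it divides both `m` and `d`. -/
theorem IsCFE.cfErr_length (hA : IsCFE α r A) (hα : α = (m : ℚ) / d) (hm : 1 ≤ m)
    (hmd : m < d) (hcop : Nat.Coprime m d) : cfErr m d A r = 1 := by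
  have h1 : ∀ i, i ≤ r → cfErr m d A r ∣ cfErr m d A (r - i) ∧
      cfErr m d A r ∣ cfErr m d A (r + 1 - i) := by
    intro i
    induction i with
    | zero =>
      intro _
      refine ⟨dvd_rfl, ?_⟩
      rw [Nat.sub_zero, hA.cfErr_last hα hm hmd]
      exact dvd_zero _
    | succ i ih =>
      intro hi
      obtain ⟨h2, h3⟩ := ih (by omega)
      have h4 := cfErr_add_two m d A (r - (i + 1))
      rw [show r - (i + 1) + 2 = r + 1 - i by omega,
        show r - (i + 1) + 1 = r - i by omega] at h4
      refine ⟨?_, by rw [show r + 1 - (i + 1) = r - i by omega]; exact h2⟩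
      rw [show cfErr m d A (r - (i + 1)) =
        cfErr m d A (r + 1 - i) + A (r + 1 - i) * cfErr m d A (r - i) by linarith]
      exact dvd_add h3 (h2.mul_left _)
  obtain ⟨h2, h3⟩ := h1 r le_rfl
  rw [Nat.sub_self, cfErr_zero hA.first] at h2
  rw [Nat.add_sub_cancel_left, cfErr_one hA.first] at h3
  have h4 : cfErr m d A r ∣ (d : ℤ) := by
    have := dvd_add h3 (h2.mul_left (A 1 : ℤ))
    simpa using this
  have h5 : IsUnit (cfErr m d A r) :=
    (Nat.isCoprime_iff_coprime.2 hcop).isUnit_of_dvd' h2 h4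
  have h6 := hA.cfErr_pos hα hm hmd le_rfl
  rcases Int.isUnit_iff.1 h5 with h | h <;> omega

theorem IsCFE.cfQ_pos (hA : IsCFE α r A) : ∀ {i : ℕ}, i ≤ r + 1 → 1 ≤ cfQ A i
  | 0, _ => le_rfl
  | 1, h => hA.one_le le_rfl h
  | i + 2, h => by
    have := hA.cfQ_pos (i := i) (by omega)
    simp only [cfQ]
    omega

theorem IsCFE.cfQ_add_le (hA : IsCFE α r A) {i : ℕ} (h : i + 2 ≤ r + 1) :
    cfQ A (i + 1) + cfQ A i ≤ cfQ A (i + 2) := by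
  have := hA.one_le (i := i + 2) (by omega) h
  simp only [cfQ]
  nlinarith

theorem IsCFE.cfQ_mono (hA : IsCFE α r A) {i k : ℕ} (hik : i ≤ k) (hk : k ≤ r + 1) :
    cfQ A i ≤ cfQ A k := by
  induction k, hik using Nat.le_induction with
  | base => exact le_rfl
  | succ k _ ih =>
    refine (ih (by omega)).trans ?_
    rcases k with _ | k
    · exact hA.cfQ_pos hk
    · exact (Nat.le_add_right _ _).trans (hA.cfQ_add_le (i := k) (by omega))

theorem stepDen_zero (A : ℕ → ℕ) (K : ℕ) : stepDen A K 0 = cfQ A (2 * K) := by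
  simp [stepDen]

theorem stepDen_last (A : ℕ → ℕ) (K : ℕ) :
    stepDen A K (A (2 * K + 2)) = cfQ A (2 * (K + 1)) := by
  rw [show 2 * (K + 1) = 2 * K + 2 by ring]
  simp only [stepDen, cfQ]
  ring

theorem stepErr_zero (m d : ℕ) (A : ℕ → ℕ) (K : ℕ) :
    stepErr m d A K 0 = cfErr m d A (2 * K) := by
  simp [stepErr]

theorem stepErr_last (m d : ℕ) (A : ℕ → ℕ) (K : ℕ) :
    stepErr m d A K (A (2 * K + 2)) = cfErr m d A (2 * (K + 1)) := by
  rw [show 2 * (K + 1) = 2 * K + 2 by ring, cfErr_add_two]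
  rfl

theorem stepErr_eq (m d : ℕ) (A : ℕ → ℕ) (K j : ℕ) :
    stepErr m d A K j =
      m * stepDen A K j - d * ((cfP A (2 * K) : ℤ) + j * cfP A (2 * K + 1)) := by
  simp only [stepErr, stepDen, cfErr, pow_succ, pow_mul]
  push_cast
  ring

theorem IsCFE.stepDen_pos (hA : IsCFE α r A) {K : ℕ} (hK : 2 * K ≤ r) (j : ℕ) :
    1 ≤ stepDen A K j :=
  (hA.cfQ_pos (by omega)).trans (Nat.le_add_right _ _)

/-- `stepErr` is congruent to `m * stepDen` mod `d`, and it lies in `[0, d)` because all errors are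
at most `m < d`. -/
theorem IsCFE.res_stepDen (hA : IsCFE α r A) (hα : α = (m : ℚ) / d) (hm : 1 ≤ m)
    (hmd : m < d) {K j : ℕ} (hK : 2 * K ≤ r)
    (hj : j * cfErr m d A (2 * K + 1) ≤ cfErr m d A (2 * K)) :
    ((m * stepDen A K j % d : ℕ) : ℤ) = stepErr m d A K j := by
  have h1 := hA.cfErr_le hα hm hmd (show 2 * K ≤ r + 1 by omega)
  have h2 := hA.cfErr_nonneg hα hm hmd (show 2 * K + 1 ≤ r + 1 by omega)
  have h3 : 0 ≤ stepErr m d A K j := by simp only [stepErr]; linarith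
  have h4 : stepErr m d A K j < d := by
    have : (m : ℤ) < d := by exact_mod_cast hmd
    have : 0 ≤ (j : ℤ) * cfErr m d A (2 * K + 1) := by positivity
    simp only [stepErr]
    linarith
  push_cast
  rw [← Int.emod_eq_of_lt h3 h4, stepErr_eq]
  simp

/-- A lattice point below a basis pair of consecutive records. -/
theorem le_of_lattice_gap {U V U' V' u v d x y : ℤ} (hd : 0 < d)
    (hdet : U * V' - U' * V = d) (hU' : 0 ≤ U') (hUU : U' < U) (hVV : V < V') (hV : 1 ≤ V)
    (hv : 1 ≤ v) (hvV : v < V') (hu : 0 ≤ u)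
    (hx : u * V' - U' * v = d * x) (hy : U * v - u * V = d * y) : U ≤ u := by
  by_contra! hlt
  -- `x` and `y` are the coordinates of `(u, v)` in the basis `(U, V)`, `(U', V')`. Once `u < U` is
  -- assumed, each sign of `x` violates one of `0 ≤ u`, `1 ≤ v < V'`, `u < U`.
  have hv' : v = x * V + y * V' := by
    apply mul_left_cancel₀ hd.ne'
    linear_combination V * hx + V' * hy - v * hdet
  have hu' : u = x * U + y * U' := by
    apply mul_left_cancel₀ hd.ne'
    linear_combination U * hx + U' * hy - u * hdet
  rcases le_or_gt x 0 with hx0 | hx0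
  · have h1 : y - 1 < -x ∨ x = 0 := by
      rcases eq_or_lt_of_le hx0 with h | h
      · exact Or.inr h
      · left
        by_contra! hcon
        nlinarith
    rcases h1 with h1 | rfl
    · rcases le_or_gt y 0 with hy0 | hy0
      · nlinarith
      · nlinarith
    · have : 0 < y := by by_contra! hcon; nlinarith
      nlinarith
  · have h1 : -y < x := by
      by_contra! hcon
      nlinarith
    nlinarith

/-- Steps `j` and `j + 1` of a segment still have determinant `d`, so the lattice gap applies. The
condition on `j` only asks that step `j + 1` have nonnegative error, not that `j + 1 ≤ A (2 * K +
2)`; this covers the extra step at the end of the expansion. -/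
theorem IsCFE.stepErr_le_res (hA : IsCFE α r A) (hα : α = (m : ℚ) / d) (hm : 1 ≤ m)
    (hmd : m < d) {K j w : ℕ} (hK : 2 * K + 1 ≤ r)
    (hj : ((j + 1 : ℕ) : ℤ) * cfErr m d A (2 * K + 1) ≤ cfErr m d A (2 * K))
    (hw : 1 ≤ w) (hwj : w < stepDen A K (j + 1)) :
    stepErr m d A K j ≤ ((m * w % d : ℕ) : ℤ) := by
  have hd : (0 : ℤ) < d := by exact_mod_cast (by omega : 0 < d)
  have he := hA.cfErr_pos hα hm hmd hK
  have hq := hA.cfQ_pos (show 2 * K + 1 ≤ r + 1 by omega)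
  obtain ⟨c, hc⟩ : (d : ℤ) ∣ ((m * w % d : ℕ) : ℤ) - m * w := by
    push_cast
    exact (Int.mod_modEq _ _).symm.dvd
  have hV := hA.stepDen_pos (show 2 * K ≤ r by omega) j
  have e1 := stepErr_eq m d A K j
  have e2 := stepErr_eq m d A K (j + 1)
  have hdet := cfQ_mul_cfErr (m := m) (d := d) hA.first (2 * K)
  have hs : stepErr m d A K (j + 1) = stepErr m d A K j - cfErr m d A (2 * K + 1) := by
    simp only [stepErr]; push_cast; ring
  have hsd : ((stepDen A K (j + 1) : ℕ) : ℤ) = stepDen A K j + cfQ A (2 * K + 1) := by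
    simp only [stepDen]; push_cast; ring
  set u : ℤ := ((m * w % d : ℕ) : ℤ) with hu
  refine le_of_lattice_gap (U := stepErr m d A K j) (V := stepDen A K j)
    (U' := stepErr m d A K (j + 1)) (V' := stepDen A K (j + 1)) (u := u) (v := w) (d := d)
    (x := c * stepDen A K (j + 1) +
      w * ((cfP A (2 * K) : ℤ) + (j + 1 : ℕ) * cfP A (2 * K + 1)))
    (y := -(c * stepDen A K j + w * ((cfP A (2 * K) : ℤ) + j * cfP A (2 * K + 1))))
    hd ?_ ?_ ?_ ?_ ?_ ?_ ?_ ?_ ?_ ?_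
  · rw [hs, hsd]
    have : (stepDen A K j : ℤ) = cfQ A (2 * K) + j * cfQ A (2 * K + 1) := by
      simp [stepDen]
    rw [this]
    simp only [stepErr]
    linear_combination hdet
  · simp only [stepErr]; linarith
  · linarith
  · rw [hsd]; have : (1 : ℤ) ≤ cfQ A (2 * K + 1) := by exact_mod_cast hq
    linarith
  · exact_mod_cast hV
  · exact_mod_cast hw
  · exact_mod_cast hwj
  · positivity
  · rw [e2]; linear_combination (stepDen A K (j + 1) : ℤ) * hc
  · rw [e1]; linear_combination -(stepDen A K j : ℤ) * hc

theorem IsCFE.isResRecord_stepDen (hA : IsCFE α r A) (hα : α = (m : ℚ) / d) (hm : 1 ≤ m)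
    (hmd : m < d) {K j : ℕ} (hK : 2 * K + 1 ≤ r)
    (hj : ((j + 1 : ℕ) : ℤ) * cfErr m d A (2 * K + 1) ≤ cfErr m d A (2 * K)) :
    IsResRecord m d (stepDen A K (j + 1)) := by
  refine ⟨hA.stepDen_pos (by omega) _, fun w hw hwj => ?_⟩
  have h1 := hA.stepErr_le_res hα hm hmd hK hj hw hwj
  have h2 := hA.res_stepDen hα hm hmd (by omega) hj
  have he := hA.cfErr_pos hα hm hmd hK
  have hs : stepErr m d A K (j + 1) = stepErr m d A K j - cfErr m d A (2 * K + 1) := by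
    simp only [stepErr]; push_cast; ring
  zify
  push_cast at h1 h2
  rw [h2]
  linarith

/-- The records after `q_{2K} + j q_{2K+1}` start at `q_{2K} + (j + 1) q_{2K+1}`. -/
theorem IsCFE.stepDen_succ_le (hA : IsCFE α r A) (hα : α = (m : ℚ) / d) (hm : 1 ≤ m)
    (hmd : m < d) {K j w : ℕ} (hK : 2 * K + 1 ≤ r)
    (hj : ((j + 1 : ℕ) : ℤ) * cfErr m d A (2 * K + 1) ≤ cfErr m d A (2 * K))
    (hw : IsResRecord m d w) (hwj : stepDen A K j < w) : stepDen A K (j + 1) ≤ w := by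
  by_contra! hcon
  have h1 := hA.stepErr_le_res hα hm hmd hK hj hw.1 hcon
  have he := hA.cfErr_pos hα hm hmd hK
  have h2 := hA.res_stepDen hα hm hmd (j := j) (show 2 * K ≤ r by omega) (by
    push_cast at hj; linarith)
  have h3 := hw.2 _ (hA.stepDen_pos (by omega) j) hwj
  rw [← h2] at h1
  exact absurd (by exact_mod_cast h1) (not_le.2 h3)

/-- On the segment from `q_{2K}` to `q_{2K+2}`, take the least step reaching `w`; no record lies
strictly between consecutive steps, so `w` equals it. -/
theorem IsCFE.exists_stepDen_of_isResRecord (hA : IsCFE α r A) (hα : α = (m : ℚ) / d)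
    (hm : 1 ≤ m) (hmd : m < d) {w : ℕ} (hw : IsResRecord m d w) :
    ∀ K, 2 * K ≤ r → w ≤ cfQ A (2 * K) →
      w = 1 ∨ ∃ k j, k < K ∧ 1 ≤ j ∧ j ≤ A (2 * k + 2) ∧ w = stepDen A k j := by
  intro K
  induction K with
  | zero =>
    intro _ h
    left
    have := hw.1
    simp only [cfQ] at h
    omega
  | succ K ih =>
    intro hK h
    rcases Nat.lt_or_ge (cfQ A (2 * K)) w with h1 | h1
    · right
      have h2 : ∃ j, w ≤ stepDen A K j := ⟨_, h.trans (stepDen_last A K).ge⟩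
      classical
      have h3 := Nat.find_spec h2
      have h4 : Nat.find h2 ≤ A (2 * K + 2) := Nat.find_min' h2 (h.trans (stepDen_last A K).ge)
      have h5 : Nat.find h2 ≠ 0 := by
        intro h0
        rw [h0, stepDen_zero] at h3
        omega
      obtain ⟨j, hj⟩ := Nat.exists_eq_succ_of_ne_zero h5
      rw [hj] at h3 h4
      have h6 : stepDen A K j < w := not_le.1 (Nat.find_min h2 (by omega))
      refine ⟨K, j + 1, by omega, by omega, by omega, le_antisymm h3 ?_⟩
      exact hA.stepDen_succ_le hα hm hmd (by omega)
        (hA.mul_cfErr_le hα hm hmd (by omega) (by omega)) hw h6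
    · rcases ih (by omega) h1 with h2 | ⟨k, j, h2, h3⟩
      · exact Or.inl h2
      · exact Or.inr ⟨k, j, by omega, h3⟩

end Expansion

/-! ### Numerations -/

section Numeration

variable {m d r : ℕ} {A : ℕ → ℕ} {α : ℚ}

theorem IsLastNonzero.one_le {D : ℕ → ℕ} {s : ℕ} (hs : IsLastNonzero D s) (h : D 0 = 0) :
    1 ≤ s := by
  rcases Nat.eq_zero_or_pos s with rfl | h1
  · exact absurd hs.1 (by omega)
  · exact h1

theorem IsAdmissible.le_length {D : ℕ → ℕ} (hD : IsAdmissible r A D) {s : ℕ} (hs : 0 < D s) :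
    s ≤ r := by
  by_contra! h
  exact absurd (hD.tail s h) hs.ne'

theorem IsAdmissible.prev_full {D : ℕ → ℕ} (hD : IsAdmissible r A D) {i j : ℕ} (hj : 1 ≤ j)
    (hji : j ≤ i) (h0 : D j = 0) (hi : 0 < D i) : 2 ≤ j ∧ D (j - 1) = A (j - 1) := by
  have hir := hD.le_length hi
  rcases hD.zero_imp j hj (by omega) h0 with h | h
  · exact absurd (h i hji) hi.ne'
  · exact h

/-- `∑_{j ≤ k} D_j q_{j-1}`. -/
def digitSum (A D : ℕ → ℕ) (k : ℕ) : ℕ := ∑ i ∈ Finset.range k, D (i + 1) * cfQ A i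

theorem digitSum_succ (A D : ℕ → ℕ) (k : ℕ) :
    digitSum A D (k + 1) = digitSum A D k + D (k + 1) * cfQ A k :=
  Finset.sum_range_succ _ _

theorem sum_Icc_one_eq_sum_range {M : Type*} [AddCommMonoid M] (f : ℕ → M) (r : ℕ) :
    ∑ j ∈ Finset.Icc 1 r, f j = ∑ i ∈ Finset.range r, f (i + 1) := by
  rw [Finset.range_eq_Ico, Finset.sum_Ico_add' f 0 r 1]
  rfl

theorem IsLastNonzero.digitSum_eq {D : ℕ → ℕ} {n s : ℕ} (hD : IsNumerationNat r A n D)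
    (hs : IsLastNonzero D s) : digitSum A D s = n := by
  rw [← hD.2, sum_Icc_one_eq_sum_range]
  refine Finset.sum_subset (Finset.range_subset_range.2 (hD.1.le_length hs.1)) ?_
  intro i _ hi
  rw [Finset.mem_range, not_lt] at hi
  rw [hs.2 (i + 1) (by omega), zero_mul]

theorem IsAdmissible.digitSum_lt {D : ℕ → ℕ} (hD : IsAdmissible r A D) :
    ∀ k, k + 1 ≤ r → digitSum A D (k + 1) + 1 ≤ cfQ A (k + 1) + cfQ A k := by
  intro k
  induction k with
  | zero =>
    intro h
    have := hD.le 1 le_rfl h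
    simp [digitSum, cfQ]
    omega
  | succ k ih =>
    intro h
    have h1 := ih (by omega)
    have h2 := Nat.mul_le_mul_right (cfQ A (k + 1)) (hD.le (k + 2) (by omega) h)
    rw [digitSum_succ, show D (k + 1 + 1) = D (k + 2) from rfl,
      show cfQ A (k + 1 + 1) = A (k + 2) * cfQ A (k + 1) + cfQ A k from rfl]
    omega

/-- A zero digit below a nonzero one is preceded by a full digit `A k`, and `A k * q_{k-1} +
q_{k-2}` rebuilds `q_k`. With `IsAdmissible.digitSum_lt`, this confines what lies below the leading
digit. -/
theorem IsAdmissible.cfQ_le_digitSum {D : ℕ → ℕ} (hD : IsAdmissible r A D)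
    (hA : IsCFE α r A) (k : ℕ) : 0 < D (k + 2) → cfQ A k ≤ digitSum A D (k + 1) := by
  induction k using Nat.strong_induction_on with
  | _ k ih =>
    intro hk
    have hkr := hD.le_length hk
    rw [digitSum_succ]
    rcases Nat.eq_zero_or_pos (D (k + 1)) with h0 | h0
    · obtain ⟨h1, h2⟩ := hD.prev_full (i := k + 2) (by omega) (by omega) h0 hk
      obtain ⟨n, rfl⟩ : ∃ n, k = n + 1 := ⟨k - 1, by omega⟩
      simp only [Nat.add_sub_cancel] at h2
      rw [h0, zero_mul, add_zero, digitSum_succ, h2]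
      rcases n with _ | n
      · simp [cfQ]
      · have h3 := hA.pos (n + 2) (by omega) (by omega)
        have h4 := ih n (by omega) (by rw [h2]; exact h3)
        rw [show cfQ A (n + 1 + 1) = A (n + 2) * cfQ A (n + 1) + cfQ A n from rfl]
        have h5 : A (n + 1 + 1) = A (n + 2) := rfl
        rw [h5]
        omega
    · have := Nat.le_mul_of_pos_left (cfQ A k) h0
      omega

/-- `∑_{j ≤ k} (-1)^{j-1} D_j d δ_{j-1}`. -/
def altDigitSum (m d : ℕ) (A D : ℕ → ℕ) (k : ℕ) : ℤ :=
  ∑ i ∈ Finset.range k, (D (i + 1) : ℤ) * (-1) ^ i * cfErr m d A i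

theorem altDigitSum_succ (m d : ℕ) (A D : ℕ → ℕ) (k : ℕ) :
    altDigitSum m d A D (k + 1) =
      altDigitSum m d A D k + (D (k + 1) : ℤ) * (-1) ^ k * cfErr m d A k :=
  Finset.sum_range_succ _ _

theorem IsNumerationRat.altDigitSum_eq {D : ℕ → ℕ} {β : ℚ} (hd : 0 < d)
    (hα : α = (m : ℚ) / d) (hD : IsNumerationRat α r A β D) :
    (altDigitSum m d A D r : ℚ) = d * β := by
  rw [← hD.2, sum_Icc_one_eq_sum_range, Finset.mul_sum, altDigitSum]
  push_cast
  refine Finset.sum_congr rfl fun i _ => ?_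
  rw [cast_cfErr hd hα]
  ring

/-- The signed tails of an admissible expansion are controlled by the neighbouring errors. -/
theorem IsAdmissible.tail_bounds {D : ℕ → ℕ} (hD : IsAdmissible r A D) (hA : IsCFE α r A)
    (hα : α = (m : ℚ) / d) (hm : 1 ≤ m) (hmd : m < d) {k : ℕ} (hk : k + 1 ≤ r) :
    -cfErr m d A (k + 1) <
        (-1) ^ (k + 1) * (altDigitSum m d A D r - altDigitSum m d A D (k + 1)) ∧
      (-1) ^ (k + 1) * (altDigitSum m d A D r - altDigitSum m d A D (k + 1)) <
        cfErr m d A k := by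
  obtain ⟨n, hn⟩ : ∃ n, k + 1 + n = r := ⟨r - (k + 1), by omega⟩
  induction n generalizing k with
  | zero =>
    obtain rfl : r = k + 1 := by omega
    have h1 := hA.cfErr_pos hα hm hmd (le_refl (k + 1))
    have h2 := hA.cfErr_pos hα hm hmd (show k ≤ k + 1 by omega)
    simp only [sub_self, mul_zero]
    constructor <;> linarith
  | succ n ih =>
    obtain ⟨h1, h2⟩ := ih (k := k + 1) (by omega) (by omega)
    have h3 := altDigitSum_succ m d A D (k + 1)
    have h4 := cfErr_add_two m d A k
    have h5 := hA.cfErr_pos hα hm hmd hk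
    have h6 : (D (k + 2) : ℤ) ≤ A (k + 2) := by
      exact_mod_cast hD.le (k + 2) (by omega) (by omega)
    -- The signed tail is the next digit times its error, minus the next signed tail; hence the two
    -- bounds feed each other.
    have h7 : (-1 : ℤ) ^ (k + 1) * (altDigitSum m d A D r - altDigitSum m d A D (k + 1)) =
        D (k + 2) * cfErr m d A (k + 1) -
          (-1) ^ (k + 1 + 1) * (altDigitSum m d A D r - altDigitSum m d A D (k + 1 + 1)) := by
      have h8 : ((-1 : ℤ) ^ (k + 1)) * (-1) ^ (k + 1) = 1 := by
        rw [← mul_pow]; norm_num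
      rw [h3, pow_succ (-1 : ℤ) (k + 1)]
      linear_combination ((D (k + 2) : ℤ) * cfErr m d A (k + 1)) * h8
    rw [h7]
    have h9 : (0 : ℤ) ≤ D (k + 2) := by positivity
    rw [show k + 1 + 1 = k + 2 from rfl] at h1 h2 ⊢
    constructor
    · nlinarith
    · nlinarith

/-- Each vanishing odd digit forces the preceding even digit to be full, so the sum telescopes
through `δ_{2i} - A_{2i+2} δ_{2i+1} = δ_{2i+2}`. -/
theorem IsAdmissible.altDigitSum_odd {D : ℕ → ℕ} (hD : IsAdmissible r A D)
    (hone : D 1 = 1) {s : ℕ} (hs : 0 < D s) :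
    ∀ T, 2 * T + 1 ≤ s → (∀ i, 1 ≤ i → i ≤ T → D (2 * i + 1) = 0) →
      altDigitSum m d A D (2 * T + 1) = cfErr m d A (2 * T) := by
  intro T
  induction T with
  | zero => intro _ _; simp [altDigitSum, hone]
  | succ T ih =>
    intro h1 h2
    have h3 := ih (by omega) (fun i hi hi' => h2 i hi (by omega))
    have h4 := h2 (T + 1) (by omega) le_rfl
    rw [show 2 * (T + 1) + 1 = 2 * T + 3 by ring] at h4 h1 ⊢
    have h5 := (hD.prev_full (by omega) h1 h4 hs).2
    rw [show 2 * T + 3 - 1 = 2 * T + 2 by omega] at h5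
    rw [show 2 * T + 3 = 2 * T + 1 + 1 + 1 by ring, altDigitSum_succ, altDigitSum_succ, h3,
      show 2 * T + 1 + 1 + 1 = 2 * T + 3 by ring, h4, show 2 * T + 1 + 1 = 2 * T + 2 by ring, h5,
      show 2 * (T + 1) = 2 * T + 2 by ring, cfErr_add_two]
    simp [pow_succ, pow_mul]
    ring

theorem altDigitSum_even (m d : ℕ) (A D : ℕ → ℕ) {T : ℕ}
    (h : altDigitSum m d A D (2 * T + 1) = cfErr m d A (2 * T)) :
    altDigitSum m d A D (2 * T + 2) = stepErr m d A T (D (2 * T + 2)) := by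
  rw [show 2 * T + 2 = 2 * T + 1 + 1 by ring, altDigitSum_succ, h]
  simp [pow_succ, pow_mul, stepErr]
  ring

/-- The numeration of a value below `α` locates it between two consecutive one-sided errors. -/
theorem IsAdmissible.tIndex_spec {D : ℕ → ℕ} (hD : IsAdmissible r A D) (hA : IsCFE α r A)
    (hα : α = (m : ℚ) / d) (hm : 1 ≤ m) (hmd : m < d) {s : ℕ} (hs : IsLastNonzero D s)
    (hlt : altDigitSum m d A D r < m) :
    ((∀ i, 0 < i → D (2 * i + 1) = 0) → Even s) ∧
    ∃ T, tIndex D s = T + 1 ∧ 2 * T + 2 ≤ r ∧ 1 ≤ D (2 * T + 2) ∧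
      stepErr m d A T (D (2 * T + 2)) ≤ altDigitSum m d A D r ∧
      altDigitSum m d A D r < stepErr m d A T (D (2 * T + 2)) + cfErr m d A (2 * T + 1) := by
  have hr := hA.one_le_length hα hmd
  have he0 := cfErr_zero (m := m) (d := d) hA.first
  have hs1 := hs.one_le hD.zero
  have hsr := hD.le_length hs.1
  -- A zero first digit would make every digit zero, and a first digit at least `2` would push the
  -- sum to `m` or more.
  have hone : D 1 = 1 := by
    have h1 : D 1 ≠ 0 := fun h => by
      have := hD.prev_full le_rfl hs1 h hs.1
      omega
    have h2 := (hD.tail_bounds hA hα hm hmd (k := 0) (by omega)).2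
    have h3 := altDigitSum_succ m d A D 0
    simp only [altDigitSum, Finset.range_zero, Finset.sum_empty] at h2 h3 hlt
    simp only [zero_add, pow_zero, pow_one, mul_one, he0] at h2 h3
    rw [h3] at h2
    have h4 : (D 1 : ℤ) < 2 := by
      by_contra! hcon
      have : (1 : ℤ) ≤ m := by exact_mod_cast hm
      nlinarith
    have : D 1 < 2 := by exact_mod_cast h4
    omega
  by_cases hex : ∃ i, 0 < i ∧ 0 < D (2 * i + 1)
  · refine ⟨fun h => ?_, ?_⟩
    · obtain ⟨i, hi, hi'⟩ := hex
      exact absurd (h i hi) hi'.ne'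
    have ht : tIndex D s = sInf {i | 0 < i ∧ 0 < D (2 * i + 1)} := if_pos hex
    have hmem : tIndex D s ∈ {i | 0 < i ∧ 0 < D (2 * i + 1)} := ht ▸ Nat.sInf_mem hex
    have hbefore : ∀ i, 1 ≤ i → i < tIndex D s → D (2 * i + 1) = 0 := by
      intro i hi hit
      by_contra hne
      have : tIndex D s ≤ i := ht ▸ Nat.sInf_le ⟨hi, Nat.pos_of_ne_zero hne⟩
      omega
    obtain ⟨T, hT⟩ : ∃ T, tIndex D s = T + 1 := ⟨tIndex D s - 1, by have := hmem.1; omega⟩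
    rw [hT] at hmem hbefore
    have hpos : 0 < D (2 * T + 3) := hmem.2
    have hTr := hD.le_length hpos
    have hodd := hD.altDigitSum_odd (m := m) (d := d) hone hpos T (by omega)
      (fun i hi hi' => hbefore i hi (by omega))
    have heven := altDigitSum_even m d A D hodd
    have hnext := altDigitSum_succ m d A D (2 * T + 2)
    have hb1 := (hD.tail_bounds hA hα hm hmd (k := 2 * T + 1) (by omega)).2
    have hb2 := (hD.tail_bounds hA hα hm hmd (k := 2 * T + 2) (by omega)).2
    have hs2 : (-1 : ℤ) ^ (2 * T + 2) = 1 := Even.neg_one_pow ⟨T + 1, by ring⟩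
    have hs3 : (-1 : ℤ) ^ (2 * T + 3) = -1 := Odd.neg_one_pow ⟨T + 1, by ring⟩
    rw [show 2 * T + 1 + 1 = 2 * T + 2 by ring, hs2] at hb1
    rw [show 2 * T + 2 + 1 = 2 * T + 3 by ring] at hb2 hnext
    rw [hs3] at hb2
    rw [hs2] at hnext
    have hE := hA.cfErr_pos hα hm hmd (show 2 * T + 2 ≤ r by omega)
    have hD1 : (1 : ℤ) ≤ D (2 * T + 3) := by exact_mod_cast hpos
    -- The positive digit at `2T + 3` contributes at least `dδ_{2T+2}`, more than the tail after it
    -- can take away.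
    have hlow : stepErr m d A T (D (2 * T + 2)) ≤ altDigitSum m d A D r := by
      rw [hnext, heven] at hb2
      nlinarith
    refine ⟨T, hT, by omega, ?_, hlow, ?_⟩
    · by_contra! hcon
      have h0 : D (2 * T + 2) = 0 := by omega
      rcases Nat.eq_zero_or_pos T with rfl | hT0
      · rw [h0, stepErr_zero, mul_zero, he0] at hlow
        omega
      · have h1 := (hD.prev_full (by omega) (show 2 * T + 2 ≤ 2 * T + 3 by omega) h0 hpos).2
        rw [show 2 * T + 2 - 1 = 2 * T + 1 by omega, hbefore T hT0 (by omega)] at h1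
        have := hA.pos (2 * T + 1) (by omega) (by omega)
        omega
    · rw [heven] at hb1
      linarith
  · have hz : ∀ i, 0 < i → D (2 * i + 1) = 0 := by
      intro i hi
      by_contra hne
      exact hex ⟨i, hi, Nat.pos_of_ne_zero hne⟩
    have hsum : altDigitSum m d A D r = altDigitSum m d A D s := by
      symm
      refine Finset.sum_subset (Finset.range_subset_range.2 hsr) ?_
      intro i _ hi
      rw [Finset.mem_range, not_lt] at hi
      rw [hs.2 (i + 1) (by omega)]
      simp
    have heven : Even s := by
      by_contra hodd
      obtain ⟨i, rfl⟩ := Nat.not_even_iff_odd.1 hodd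
      rcases Nat.eq_zero_or_pos i with rfl | hi
      · have h1 := hD.altDigitSum_odd (m := m) (d := d) hone hs.1 0 (by omega) (by omega)
        rw [hsum, h1, mul_zero, he0] at hlt
        omega
      · exact absurd (hz i hi) hs.1.ne'
    refine ⟨fun _ => heven, ?_⟩
    obtain ⟨n, hn⟩ := heven
    obtain ⟨T, rfl⟩ : ∃ T, n = T + 1 := ⟨n - 1, by omega⟩
    obtain rfl : s = 2 * T + 2 := by omega
    have h1 := hD.altDigitSum_odd (m := m) (d := d) hone hs.1 T (by omega)
      (fun i hi _ => hz i hi)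
    have h2 := altDigitSum_even m d A D h1
    have hE := hA.cfErr_pos hα hm hmd (show 2 * T + 1 ≤ r by omega)
    refine ⟨T, ?_, hsr, hs.1, by rw [hsum, h2], by rw [hsum, h2]; linarith⟩
    rw [tIndex, if_neg hex]
    omega

end Numeration

/-! ### Records below `a` and the numeration of `a - 1` -/

section Records

variable {a b m d r : ℕ} {A : ℕ → ℕ} {α : ℚ}

theorem stepDen_strictMono (hA : IsCFE α r A) {K : ℕ} (hK : 2 * K + 1 ≤ r) :
    StrictMono (stepDen A K) := by
  intro i j hij
  have := hA.cfQ_pos (show 2 * K + 1 ≤ r + 1 by omega)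
  have := Nat.mul_lt_mul_of_pos_right hij this
  simp only [stepDen]
  omega

theorem stepErr_antitone (hA : IsCFE α r A) (hα : α = (m : ℚ) / d) (hm : 1 ≤ m) (hmd : m < d)
    {K : ℕ} (hK : 2 * K + 1 ≤ r) : Antitone (stepErr m d A K) := by
  intro i j hij
  have := hA.cfErr_pos hα hm hmd hK
  have : (i : ℤ) ≤ j := by exact_mod_cast hij
  simp only [stepErr]
  nlinarith

/-- The leading digit of the numeration of `a - 1`, for an even leading position. -/
theorem IsNumerationNat.even_bounds (hA : IsCFE α r A) (ha : 0 < a) {N : ℕ → ℕ} {K : ℕ}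
    (hN : IsNumerationNat r A (a - 1) N) (hs : IsLastNonzero N (2 * K + 2)) :
    stepDen A K (N (2 * K + 2)) < a ∧ a ≤ stepDen A K (N (2 * K + 2) + 1) := by
  have h1 := hs.digitSum_eq hN
  have h2 := hN.1.digitSum_lt (2 * K) (by have := hN.1.le_length hs.1; omega)
  have h3 := hN.1.cfQ_le_digitSum hA (2 * K) hs.1
  rw [show 2 * K + 2 = 2 * K + 1 + 1 by ring, digitSum_succ] at h1
  simp only [stepDen]
  rw [show 2 * K + 1 + 1 = 2 * K + 2 by ring] at h1
  rw [add_one_mul]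
  omega

/-- The leading digit of the numeration of `a - 1`, for an odd leading position. -/
theorem IsNumerationNat.odd_bounds (ha : 0 < a) {N : ℕ → ℕ} {K : ℕ}
    (hN : IsNumerationNat r A (a - 1) N) (hs : IsLastNonzero N (2 * K + 1)) :
    stepDen A K 0 < a ∧ a ≤ stepDen A K 1 := by
  have h1 := hs.digitSum_eq hN
  have h2 := hN.1.digitSum_lt (2 * K) (hN.1.le_length hs.1)
  have h3 := Nat.le_mul_of_pos_left (cfQ A (2 * K)) hs.1
  rw [h1] at h2
  rw [digitSum_succ] at h1
  simp only [stepDen]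
  omega

theorem aPrime_le {N : ℕ → ℕ} {s k : ℕ} (hN : IsAdmissible r A N) (hs : 0 < N s)
    (hk : 1 ≤ k) (hks : k ≤ s / 2) : 2 * k ≤ r ∧ aPrime A N s k ≤ A (2 * k) := by
  have hsr := hN.le_length hs
  refine ⟨by omega, ?_⟩
  unfold aPrime
  split_ifs with h
  · exact le_rfl
  · obtain rfl : s = 2 * k := by omega
    exact hN.le _ (by omega) hsr

/-- The smallest residue of `m w` over `1 ≤ w < a`, and where it is attained. -/
theorem IsNumerationNat.exists_min_res (hA : IsCFE α r A) (hα : α = (m : ℚ) / d) (hm : 1 ≤ m)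
    (hmd : m < d) (ha : 0 < a) {N : ℕ → ℕ} {s : ℕ} (hN : IsNumerationNat r A (a - 1) N)
    (hs : IsLastNonzero N s) :
    ∃ K J : ℕ, 2 * K ≤ r ∧ J * cfErr m d A (2 * K + 1) ≤ cfErr m d A (2 * K) ∧
      stepDen A K J < a ∧ (stepErr m d A K J : ℚ) = xZero d α A N s ∧
      (∀ w, 1 ≤ w → w < a → stepErr m d A K J ≤ ((m * w % d : ℕ) : ℤ)) ∧
      ((s = 2 * K + 2 ∧ J = N s) ∨ (s = 2 * K + 1 ∧ J = 0)) := by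
  have hd : 0 < d := by omega
  have hs1 := hs.one_le hN.1.zero
  have hsr := hN.1.le_length hs.1
  rcases Nat.even_or_odd' s with ⟨c, rfl | rfl⟩
  · obtain ⟨K, rfl⟩ : ∃ K, c = K + 1 := ⟨c - 1, by omega⟩
    rw [show 2 * (K + 1) = 2 * K + 2 by ring] at *
    obtain ⟨h1, h2⟩ := hN.even_bounds hA ha hs
    have hle := hN.1.le _ hs1 hsr
    refine ⟨K, N (2 * K + 2), by omega,
      hA.mul_cfErr_le hα hm hmd (by omega) hle, h1, ?_, ?_, Or.inl ⟨rfl, rfl⟩⟩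
    · rw [xZero, if_pos ⟨K + 1, by ring⟩, stepErr]
      push_cast
      rw [cast_cfErr hd hα, cast_cfErr hd hα]
      ring
    · intro w hw hwa
      rcases Nat.lt_or_ge (N (2 * K + 2)) (A (2 * K + 2)) with hlt | hge
      · exact hA.stepErr_le_res hα hm hmd (by omega)
          (hA.mul_cfErr_le hα hm hmd (by omega) hlt) hw (by omega)
      -- A full leading digit ends the segment. The bound then comes from the first step of the next
      -- segment, or, if `r = 2K + 2`, from the extra step granted by the last quotient `1`.
      · have heq : N (2 * K + 2) = A (2 * K + 2) := le_antisymm hle hge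
        rcases Nat.lt_or_ge (2 * K + 2) r with hr | hr
        · rw [heq, stepErr_last, ← stepErr_zero]
          refine hA.stepErr_le_res hα hm hmd (by omega) ?_ hw (hwa.trans_le (h2.trans ?_))
          · simpa using hA.cfErr_succ_le hα hm hmd (show 2 * (K + 1) ≤ r by omega)
          · have h3 := stepDen_last A K
            have h4 := hA.cfQ_mono (show 2 * K + 1 ≤ 2 * (K + 1) + 1 by omega) (by omega)
            rw [heq]
            simp only [stepDen] at h3 ⊢
            rw [add_one_mul, zero_add, one_mul]
            omega
        · obtain rfl : r = 2 * K + 2 := by omega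
          refine hA.stepErr_le_res hα hm hmd (by omega) ?_ hw (by omega)
          have h3 := hA.cfErr_prev_last hα hm hmd
          have h4 := cfErr_add_two m d A (2 * K)
          rw [show 2 * K + 2 - 1 = 2 * K + 1 by omega] at h3
          rw [heq]
          push_cast
          linarith
  · obtain ⟨h1, h2⟩ := hN.odd_bounds ha hs
    refine ⟨c, 0, by omega, ?_, h1, ?_, ?_, Or.inr ⟨rfl, rfl⟩⟩
    · simpa using hA.cfErr_nonneg hα hm hmd (show 2 * c ≤ r + 1 by omega)
    · rw [xZero, if_neg (Nat.not_even_iff_odd.2 ⟨c, rfl⟩), stepErr_zero, cast_cfErr hd hα]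
      rfl
    · intro w hw hwa
      refine hA.stepErr_le_res hα hm hmd hsr ?_ hw (by simpa using hwa.trans_le h2)
      simpa using hA.cfErr_succ_le hα hm hmd (show 2 * c ≤ r by omega)

theorem stepDen_le_cfQ (hA : IsCFE α r A) {k j n : ℕ} (hk : 2 * k + 2 ≤ n) (hn : n ≤ r + 1)
    (hj : j ≤ A (2 * k + 2)) : stepDen A k j ≤ cfQ A n := by
  refine le_trans ?_ (hA.cfQ_mono hk hn)
  rw [show 2 * k + 2 = 2 * (k + 1) by ring, ← stepDen_last]
  exact Nat.add_le_add_left (Nat.mul_le_mul_right _ hj) _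

/-- The records below `a` are read off the numeration of `a - 1`. -/
theorem IsNumerationNat.isResRecord_lt_iff (hA : IsCFE α r A) (hα : α = (m : ℚ) / d)
    (hm : 1 ≤ m) (hmd : m < d) (ha : 0 < a) {N : ℕ → ℕ} {s : ℕ}
    (hN : IsNumerationNat r A (a - 1) N) (hs : IsLastNonzero N s) (w : ℕ) :
    (IsResRecord m d w ∧ w < a) ↔
      w = 1 ∨ ∃ k j, 1 ≤ k ∧ k ≤ s / 2 ∧ 1 ≤ j ∧ j ≤ aPrime A N s k ∧
        w = stepDen A (k - 1) j := by
  have hsr := hN.1.le_length hs.1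
  obtain ⟨K, J, hK, hJ, hVa, -, hmin, hcase⟩ := hN.exists_min_res hA hα hm hmd ha hs
  have hV1 := hA.stepDen_pos hK J
  constructor
  · rintro ⟨hw, hwa⟩
    -- A record beyond the point attaining the minimum would have a smaller residue.
    have hwV : w ≤ stepDen A K J := by
      by_contra! hcon
      have h1 := hw.2 _ hV1 hcon
      have h2 := hmin w hw.1 hwa
      rw [← hA.res_stepDen hα hm hmd hK hJ] at h2
      exact absurd (by exact_mod_cast h2) (not_le.2 h1)
    rcases hcase with ⟨hsK, hJN⟩ | ⟨hsK, hJ0⟩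
    · have hle : J ≤ A (2 * K + 2) := by
        rw [hJN, hsK]; exact hN.1.le _ (by omega) (by omega)
      rcases hA.exists_stepDen_of_isResRecord hα hm hmd hw (K + 1) (by omega)
        (hwV.trans (stepDen_le_cfQ hA le_rfl (by omega) hle)) with h | ⟨k, j, hk, hj, hj', rfl⟩
      · exact Or.inl h
      · refine Or.inr ⟨k + 1, j, by omega, by omega, hj, ?_, rfl⟩
        unfold aPrime
        split_ifs with h
        · exact hj'
        · obtain rfl : k = K := by omega
          rw [← hJN]
          exact (stepDen_strictMono hA (by omega)).le_iff_le.1 hwV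
    · rw [hJ0, stepDen_zero] at hwV
      rcases hA.exists_stepDen_of_isResRecord hα hm hmd hw K hK hwV with
        h | ⟨k, j, hk, hj, hj', rfl⟩
      · exact Or.inl h
      · refine Or.inr ⟨k + 1, j, by omega, by omega, hj, ?_, rfl⟩
        rw [aPrime, if_pos (by omega)]
        exact hj'
  · rintro (rfl | ⟨k, j, hk, hks, hj, hj', rfl⟩)
    · exact ⟨⟨le_rfl, fun w h1 h2 => by omega⟩, by omega⟩
    · obtain ⟨h1, h2⟩ := aPrime_le hN.1 hs.1 hk hks
      obtain ⟨k, rfl⟩ : ∃ n, k = n + 1 := ⟨k - 1, by omega⟩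
      obtain ⟨j, rfl⟩ : ∃ n, j = n + 1 := ⟨j - 1, by omega⟩
      rw [Nat.add_sub_cancel]
      refine ⟨hA.isResRecord_stepDen hα hm hmd (by omega)
        (hA.mul_cfErr_le hα hm hmd (by omega) (hj'.trans h2)), lt_of_le_of_lt ?_ hVa⟩
      by_cases hlast : 2 * (k + 1) < s
      · refine (stepDen_le_cfQ hA (n := 2 * K) (by omega) (by omega) (hj'.trans h2)).trans ?_
        exact Nat.le_add_right _ _
      · rw [aPrime, if_neg hlast] at hj'
        rcases hcase with ⟨hsK, hJN⟩ | ⟨hsK, hJ0⟩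
        · obtain rfl : k = K := by omega
          exact (stepDen_strictMono hA (by omega)).le_iff_le.2 (hJN ▸ hj')
        · omega

/-- On the basis `(U, q')`, `(-D, q)` the form `(a u + b v) / d` takes the values `y` and `-x`, and
inverting gives `a = q y + q' x`, `b = D y - U x`. The lower bound on `a` and `b ≤ n D` give `x ≥
1`; the upper bound on `a` gives `y ≤ n + 1`; `b > 0` gives `y ≥ c + 1`. So `x = 1`, `y = c + 1`, `n
= c`, and the determinant becomes the combination of `a` and `b`. -/
theorem eq_combination_of_last_segment {a b d q q' U D E c n x y : ℤ} (hd : 0 < d)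
    (hq : 1 ≤ q) (hq' : 1 ≤ q') (hD : 0 < D) (hE : 0 ≤ E) (hdet : q * U + q' * D = d)
    (hrec : E = U - c * D) (hy : a * U + b * q' = d * y) (hx : a * D - b * q = d * x)
    (hlo : q' + n * q < a) (hhi : a ≤ q' + (n + 1) * q) (hbn : b ≤ n * D) (hn : 0 ≤ n)
    (hnc : n ≤ c) (hb : 0 < b) : d = E * a + (c * q + q') * b := by
  have haq : a = q * y + q' * x := by
    apply mul_left_cancel₀ hd.ne'
    linear_combination q * hy + q' * hx - a * hdet
  have hbq : b = D * y - U * x := by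
    apply mul_left_cancel₀ hd.ne'
    linear_combination D * hy - U * hx - b * hdet
  have hx1 : 1 ≤ x := by
    by_contra! hcon
    have h1 := mul_lt_mul_of_pos_right hlo hD
    have h2 := mul_le_mul_of_nonneg_right hbn (by linarith : 0 ≤ q)
    have h3 : 0 < q' * D := by positivity
    have h4 : d * x ≤ 0 := mul_nonpos_of_nonneg_of_nonpos hd.le (by omega)
    linarith
  have h5 : q' ≤ q' * x := le_mul_of_one_le_right (by omega) hx1
  have hy1 : y ≤ n + 1 := by
    by_contra! hcon
    have h6 := mul_lt_mul_of_pos_left hcon (by linarith : 0 < q)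
    linarith
  have hU : 0 ≤ U := by
    have : 0 ≤ c * D := mul_nonneg (by omega) hD.le
    linarith
  have hy2 : c + 1 ≤ y := by
    by_contra! hcon
    have h6 := mul_le_mul_of_nonneg_left (show y ≤ c by omega) hD.le
    have h7 : U ≤ U * x := le_mul_of_one_le_right hU hx1
    linarith
  obtain rfl : y = c + 1 := by linarith
  obtain rfl : n = c := by linarith
  obtain rfl : x = 1 := by
    by_contra hne
    have := mul_le_mul_of_nonneg_left (show 2 ≤ x by omega) (by omega : 0 ≤ q')
    linarith
  rw [haq, hbq, ← hdet, hrec]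
  ring

/-- If all remaining records lie on the last segment of the polygon, then `d ∈ ⟨a, b⟩`. -/
theorem mem_closure_of_last_segment (hA : IsCFE α r A) (hα : α = (m : ℚ) / d) (hm : 1 ≤ m)
    (hmd : m < d) (hb : 0 < b) (hdvd : d ∣ a * m + b) {T n : ℕ} (hT : 2 * T + 2 ≤ r)
    (hn : n ≤ A (2 * T + 2)) (hlo : stepDen A T n < a) (hhi : a ≤ stepDen A T (n + 1))
    (hbn : (b : ℤ) ≤ n * cfErr m d A (2 * T + 1)) :
    d ∈ AddSubmonoid.closure ({a, b} : Set ℕ) := by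
  have hdet := cfQ_mul_cfErr (m := m) (d := d) hA.first (2 * T)
  have hE0 := hA.cfErr_nonneg hα hm hmd (show 2 * T + 2 ≤ r + 1 by omega)
  have hD0 := hA.cfErr_pos hα hm hmd (show 2 * T + 1 ≤ r by omega)
  have hrec := cfErr_add_two m d A (2 * T)
  have hq : (1 : ℤ) ≤ cfQ A (2 * T + 1) := by
    exact_mod_cast hA.cfQ_pos (show 2 * T + 1 ≤ r + 1 by omega)
  have hq' : (1 : ℤ) ≤ cfQ A (2 * T) := by
    exact_mod_cast hA.cfQ_pos (show 2 * T ≤ r + 1 by omega)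
  have hd : (0 : ℤ) < d := by exact_mod_cast (by omega : 0 < d)
  obtain ⟨y, hy⟩ : (d : ℤ) ∣ a * cfErr m d A (2 * T) + b * cfQ A (2 * T) := by
    have h : (d : ℤ) ∣ (a * m + b) * cfQ A (2 * T) :=
      Dvd.dvd.mul_right (by exact_mod_cast hdvd) _
    obtain ⟨c, hc⟩ := h
    refine ⟨c - a * cfP A (2 * T), ?_⟩
    simp only [cfErr, pow_mul, even_two, Even.neg_pow, one_pow]
    linear_combination hc
  obtain ⟨x, hx⟩ : (d : ℤ) ∣ a * cfErr m d A (2 * T + 1) - b * cfQ A (2 * T + 1) := by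
    have h : (d : ℤ) ∣ (a * m + b) * cfQ A (2 * T + 1) :=
      Dvd.dvd.mul_right (by exact_mod_cast hdvd) _
    obtain ⟨c, hc⟩ := h
    refine ⟨-c + a * cfP A (2 * T + 1), ?_⟩
    rw [cfErr, Odd.neg_one_pow ⟨T, rfl⟩]
    linear_combination -hc
  have hlo' : (cfQ A (2 * T) : ℤ) + n * cfQ A (2 * T + 1) < a := by
    simp only [stepDen] at hlo; exact_mod_cast hlo
  have hhi' : (a : ℤ) ≤ cfQ A (2 * T) + (n + 1) * cfQ A (2 * T + 1) := by
    simp only [stepDen] at hhi; exact_mod_cast hhi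
  have hn' : (n : ℤ) ≤ A (2 * T + 2) := by exact_mod_cast hn
  have hb' : (0 : ℤ) < b := by exact_mod_cast hb
  have hc0 : (0 : ℤ) ≤ n := by positivity
  have key := eq_combination_of_last_segment hd hq hq' hD0 hE0 hdet hrec hy hx hlo' hhi' hbn
    hc0 hn' hb'
  rw [AddSubmonoid.mem_closure_pair]
  refine ⟨(cfErr m d A (2 * T + 2)).toNat, cfQ A (2 * T + 2), ?_⟩
  zify
  simp only [smul_eq_mul, cfQ]
  push_cast
  rw [Int.toNat_of_nonneg hE0, key]

end Records

/-! ### The lists of irreducible elements -/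

theorem IrrListedBy.embDim_eq {S : AddSubmonoid ℕ} {M : Multiset ℤ} (h : IrrListedBy S M) :
    embDim S = M.card := by
  classical
  have h1 : ((fun x : ℕ => (x : ℤ)) '' semigroupIrr S).ncard = (semigroupIrr S).ncard :=
    Set.ncard_image_of_injective _ Nat.cast_injective
  have h2 : {x | x ∈ M} = ((M.toFinset : Finset ℤ) : Set ℤ) := by ext x; simp
  rw [embDim, ← h1, h.2, h2, Set.ncard_coe_finset, Multiset.toFinset_card_of_nodup h.1]

/-- The family of the denominators `q_{2k-2} + j q_{2k-1}` for `k₀ ≤ k ≤ k₁`,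
`lo k ≤ j ≤ hi k`. -/
def denFamily (A : ℕ → ℕ) (k₀ k₁ : ℕ) (lo hi : ℕ → ℕ) : Multiset ℕ :=
  (Finset.Icc k₀ k₁).val.bind fun k =>
    (Finset.Icc (lo k) (hi k)).val.map fun j => stepDen A (k - 1) j

theorem mem_denFamily {A : ℕ → ℕ} {k₀ k₁ : ℕ} {lo hi : ℕ → ℕ} {w : ℕ} :
    w ∈ denFamily A k₀ k₁ lo hi ↔
      ∃ k j, k₀ ≤ k ∧ k ≤ k₁ ∧ lo k ≤ j ∧ j ≤ hi k ∧ w = stepDen A (k - 1) j := by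
  simp only [denFamily, Multiset.mem_bind, Finset.mem_val, Finset.mem_Icc, Multiset.mem_map]
  constructor
  · rintro ⟨k, ⟨h1, h2⟩, j, ⟨h3, h4⟩, rfl⟩
    exact ⟨k, j, h1, h2, h3, h4, rfl⟩
  · rintro ⟨k, j, h1, h2, h3, h4, rfl⟩
    exact ⟨k, ⟨h1, h2⟩, j, ⟨h3, h4⟩, rfl⟩

theorem card_denFamily (A : ℕ → ℕ) (k₀ k₁ : ℕ) (lo hi : ℕ → ℕ) :
    (denFamily A k₀ k₁ lo hi).card = ∑ k ∈ Finset.Icc k₀ k₁, (hi k + 1 - lo k) := by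
  rw [denFamily, Multiset.card_bind]
  refine congrArg Multiset.sum (Multiset.map_congr rfl fun k _ => ?_)
  simp

theorem sum_aPrime {A N : ℕ → ℕ} {s k₀ : ℕ} (hs : 1 ≤ s) (hk : Even s → k₀ ≤ s / 2) :
    ∑ k ∈ Finset.Icc k₀ (s / 2), aPrime A N s k =
      ∑ k ∈ Finset.Icc k₀ ((s - 1) / 2), A (2 * k) + nuTerm N s := by
  rcases Nat.even_or_odd' s with ⟨c, rfl | rfl⟩
  · have h1 := hk ⟨c, by ring⟩
    obtain ⟨c, rfl⟩ : ∃ n, c = n + 1 := ⟨c - 1, by omega⟩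
    rw [show 2 * (c + 1) / 2 = c + 1 by omega] at h1 ⊢
    rw [Finset.sum_Icc_succ_top h1, show (2 * (c + 1) - 1) / 2 = c by omega, nuTerm,
      if_pos ⟨c + 1, by ring⟩, aPrime, if_neg (by omega)]
    congr 1
    refine Finset.sum_congr rfl fun k hk' => ?_
    rw [Finset.mem_Icc] at hk'
    rw [aPrime, if_pos (by omega)]
  · rw [nuTerm, if_neg (Nat.not_even_iff_odd.2 ⟨c, rfl⟩), add_zero,
      show (2 * c + 1) / 2 = c by omega, show (2 * c + 1 - 1) / 2 = c by omega]
    refine Finset.sum_congr rfl fun k hk' => ?_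
    rw [Finset.mem_Icc] at hk'
    rw [aPrime, if_pos (by omega)]

section Lists

variable {a b m d r : ℕ} {A : ℕ → ℕ} {α : ℚ}

/-- Within a segment the denominators increase, and those of segment `k` lie in `(q_{2k-2},
q_{2k}]`, so distinct segments are disjoint. -/
theorem nodup_denFamily (hA : IsCFE α r A) {k₀ k₁ : ℕ} {lo hi : ℕ → ℕ}
    (hlo : ∀ k, k₀ ≤ k → k ≤ k₁ → 1 ≤ lo k)
    (h : ∀ k, k₀ ≤ k → k ≤ k₁ → 1 ≤ k ∧ 2 * k ≤ r ∧ hi k ≤ A (2 * k)) :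
    (denFamily A k₀ k₁ lo hi).Nodup := by
  have hdisj : ∀ k l i j, k₀ ≤ k → l ≤ k₁ → k < l → i ≤ hi k → lo l ≤ j →
      stepDen A (k - 1) i < stepDen A (l - 1) j := by
    intro k l i j hk hl hkl hi' hj
    obtain ⟨h1, h2, h3⟩ := h k hk (by omega)
    obtain ⟨h4, h5, h6⟩ := h l (by omega) hl
    have h7 := hlo l (by omega) hl
    refine lt_of_le_of_lt (stepDen_le_cfQ hA (n := 2 * (l - 1)) (by omega) (by omega) ?_) ?_
    · rw [show 2 * (k - 1) + 2 = 2 * k by omega]; omega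
    · rw [← stepDen_zero]
      exact stepDen_strictMono hA (by omega) (by omega)
  refine Multiset.nodup_bind.2 ⟨fun k hk => ?_, ?_⟩
  · rw [Finset.mem_val, Finset.mem_Icc] at hk
    obtain ⟨h1, h2, h3⟩ := h k hk.1 hk.2
    exact (Finset.nodup _).map (stepDen_strictMono hA (by omega)).injective
  · refine (Finset.nodup _).pairwise ?_
    intro k hk l hl hkl
    rw [Finset.mem_val, Finset.mem_Icc] at hk hl
    rw [Function.onFun, Multiset.disjoint_left]
    intro x hx hx'
    simp only [Multiset.mem_map, Finset.mem_val, Finset.mem_Icc] at hx hx'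
    obtain ⟨i, hi1, rfl⟩ := hx
    obtain ⟨j, hj1, hj2⟩ := hx'
    rcases Nat.lt_or_gt_of_ne hkl with hlt | hlt
    · exact absurd hj2 (hdisj k l i j hk.1 hl.2 hlt hi1.2 hj1.1).ne'
    · exact absurd hj2 (hdisj l k j i hl.1 hk.2 hlt hj1.2 hi1.1).ne

theorem one_notMem_denFamily (hA : IsCFE α r A) {k₀ k₁ : ℕ} {lo hi : ℕ → ℕ}
    (hlo : ∀ k, k₀ ≤ k → k ≤ k₁ → 1 ≤ lo k)
    (h : ∀ k, k₀ ≤ k → k ≤ k₁ → 1 ≤ k ∧ 2 * k ≤ r ∧ hi k ≤ A (2 * k)) :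
    1 ∉ denFamily A k₀ k₁ lo hi := by
  rw [mem_denFamily]
  rintro ⟨k, j, h1, h2, h3, h4, h5⟩
  obtain ⟨h6, h7, -⟩ := h k h1 h2
  have h8 := hlo k h1 h2
  have h9 := stepDen_strictMono hA (K := k - 1) (by omega) (show 0 < j by omega)
  have h10 := hA.stepDen_pos (K := k - 1) (by omega) 0
  omega

/-- As `d τ = a m + b`, `μ_i` is the value of `(a u + b v) / d` at `(q_i m - p_i d, q_i)`; linearity
handles the intermediate points. -/
theorem muFamily_eq_map (hA : IsCFE α r A) (hα : α = (m : ℚ) / d) (hm : 1 ≤ m) (hmd : m < d)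
    (hdvd : d ∣ a * m + b) {μ : ℕ → ℤ}
    (hμ : ∀ i, μ i = (((a * m + b) / d : ℕ) : ℤ) * cfQ A i - a * cfP A i)
    {k₀ k₁ : ℕ} {lo hi : ℕ → ℕ}
    (h : ∀ k, k₀ ≤ k → k ≤ k₁ → 1 ≤ k ∧ 2 * k ≤ r ∧ hi k ≤ A (2 * k)) :
    muFamily μ k₀ k₁ lo hi =
      (denFamily A k₀ k₁ lo hi).map fun v => (resVal a b d m v : ℤ) := by
  have hd : (d : ℤ) ≠ 0 := by exact_mod_cast (by omega : d ≠ 0)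
  rw [muFamily, denFamily, Multiset.map_bind]
  refine Multiset.bind_congr fun k hk => ?_
  simp only [Multiset.bind_def, Multiset.pure_def, Multiset.bind_singleton, Multiset.map_map]
  refine Multiset.map_congr rfl fun j hj => ?_
  rw [Finset.mem_val, Finset.mem_Icc] at hk hj
  obtain ⟨h1, h2, h3⟩ := h k hk.1 hk.2
  obtain ⟨K, rfl⟩ : ∃ n, k = n + 1 := ⟨k - 1, by omega⟩
  rw [Function.comp_apply, Function.comp_apply, Nat.add_sub_cancel, show 2 * (K + 1) - 2 = 2 * K by omega,
    show 2 * (K + 1) - 1 = 2 * K + 1 by omega]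
  apply mul_left_cancel₀ hd
  have e1 : (d : ℤ) * resVal a b d m (stepDen A K j) =
      a * stepErr m d A K j + b * stepDen A K j := by
    rw [← hA.res_stepDen hα hm hmd (by omega)
      (hA.mul_cfErr_le hα hm hmd (by omega) (hj.2.trans h3))]
    exact_mod_cast mul_resVal hdvd _
  have e2 : (d : ℤ) * (((a * m + b) / d : ℕ) : ℤ) = a * m + b := by
    exact_mod_cast Nat.mul_div_cancel' hdvd
  rw [e1, stepErr_eq, hμ, hμ]
  simp only [stepDen]
  push_cast at e2 ⊢
  linear_combination ((cfQ A (2 * K) : ℤ) + j * cfQ A (2 * K + 1)) * e2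

theorem resVal_ne_left (hab : Nat.Coprime a b) (hdvd : d ∣ a * m + b) {v : ℕ} (hv : 1 ≤ v)
    (hva : v < a) : resVal a b d m v ≠ a := by
  intro h
  have h1 := mul_resVal hdvd v
  rw [h] at h1
  have h2 : a ∣ b * v :=
    (Nat.dvd_add_right (dvd_mul_right a (m * v % d))).1 (h1 ▸ dvd_mul_left a d)
  have := Nat.le_of_dvd hv (hab.dvd_of_dvd_mul_left h2)
  omega

theorem irrListedBy_map (hab : Nat.Coprime a b) (hdvd : d ∣ a * m + b) {S : AddSubmonoid ℕ}
    {G : Multiset ℕ} (hG : G.Nodup) (hGa : ∀ v ∈ G, v < a)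
    (hirr : ∀ x, x ∈ semigroupIrr S ↔ ∃ v ∈ G, x = resVal a b d m v) :
    IrrListedBy S (G.map fun v => (resVal a b d m v : ℤ)) := by
  refine ⟨hG.map_on fun v hv w hw h => ?_, ?_⟩
  · exact resVal_injOn hab hdvd (hGa v hv) (hGa w hw) (by exact_mod_cast h)
  · ext y
    simp only [Set.mem_image, hirr, Multiset.mem_map, Set.mem_ofPred_eq]
    constructor
    · rintro ⟨x, ⟨v, hv, rfl⟩, rfl⟩
      exact ⟨v, hv, rfl⟩
    · rintro ⟨v, hv, rfl⟩
      exact ⟨_, ⟨v, hv, rfl⟩, rfl⟩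

theorem irrListedBy_cons_map (hab : Nat.Coprime a b) (hdvd : d ∣ a * m + b)
    {S : AddSubmonoid ℕ} {G : Multiset ℕ} (hG : G.Nodup) (hGa : ∀ v ∈ G, 1 ≤ v ∧ v < a)
    (hirr : ∀ x, x ∈ semigroupIrr S ↔ x = a ∨ ∃ v ∈ G, x = resVal a b d m v) :
    IrrListedBy S ((a : ℤ) ::ₘ G.map fun v => (resVal a b d m v : ℤ)) := by
  refine ⟨Multiset.nodup_cons.2 ⟨?_, hG.map_on fun v hv w hw h => ?_⟩, ?_⟩
  · rw [Multiset.mem_map]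
    rintro ⟨v, hv, h⟩
    exact resVal_ne_left hab hdvd (hGa v hv).1 (hGa v hv).2 (by exact_mod_cast h)
  · exact resVal_injOn hab hdvd (hGa v hv).2 (hGa w hw).2 (by exact_mod_cast h)
  · ext y
    simp only [Set.mem_image, hirr, Multiset.mem_cons, Multiset.mem_map, Set.mem_ofPred_eq]
    constructor
    · rintro ⟨x, rfl | ⟨v, hv, rfl⟩, rfl⟩
      · exact Or.inl rfl
      · exact Or.inr ⟨v, hv, rfl⟩
    · rintro (rfl | ⟨v, hv, rfl⟩)
      · exact ⟨a, Or.inl rfl, rfl⟩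
      · exact ⟨_, Or.inr ⟨v, hv, rfl⟩, rfl⟩

theorem resVal_one (hmd : m < d) : resVal a b d m 1 = (a * m + b) / d := by
  simp [resVal, Nat.mod_eq_of_lt hmd]

theorem resVal_self (hd : 0 < d) : resVal a b d m d = b := by
  simp [resVal, Nat.mul_div_cancel _ hd]

/-- All records: `1`, the intermediate denominators, and `d`. -/
theorem IsCFE.isResRecord_iff (hA : IsCFE α r A) (hα : α = (m : ℚ) / d) (hm : 1 ≤ m)
    (hmd : m < d) (hcop : Nat.Coprime m d) (w : ℕ) :
    IsResRecord m d w ↔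
      w = d ∨ w = 1 ∨ ∃ k j, 1 ≤ k ∧ k ≤ r / 2 ∧ 1 ≤ j ∧ j ≤ A (2 * k) ∧
        w = stepDen A (k - 1) j := by
  have hd : 0 < d := by omega
  have hr := hA.one_le_length hα hmd
  have hdvd : ∀ v, 1 ≤ v → m * v % d = 0 → d ≤ v := fun v hv h =>
    Nat.le_of_dvd hv (hcop.symm.dvd_of_dvd_mul_left (Nat.dvd_of_mod_eq_zero h))
  -- The last even-indexed convergent already has residue `1`, so the only later record is `d`, of
  -- residue `0`.
  have hlast : cfErr m d A (2 * (r / 2)) = 1 := by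
    have h1 := hA.cfErr_length hα hm hmd hcop
    rcases Nat.even_or_odd' r with ⟨c, hc | hc⟩
    · rw [show 2 * (r / 2) = r by omega, h1]
    · rw [show 2 * (r / 2) = r - 1 by omega, hA.cfErr_prev_last hα hm hmd, h1]
  constructor
  · intro hw
    rcases Nat.lt_or_ge (cfQ A (2 * (r / 2))) w with h | h
    · left
      have h1 := hA.res_stepDen hα hm hmd (K := r / 2) (j := 0) (by omega) (by simp [hlast])
      rw [stepErr_zero, stepDen_zero, hlast] at h1
      have h2 := hw.2 _ (hA.cfQ_pos (by omega)) h
      have h3 : m * cfQ A (2 * (r / 2)) % d = 1 := by exact_mod_cast h1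
      refine le_antisymm ?_ (hdvd w hw.1 (by omega))
      by_contra! hcon
      have := hw.2 d hd hcon
      simp at this
    · right
      rcases hA.exists_stepDen_of_isResRecord hα hm hmd hw (r / 2) (by omega) h with
        h1 | ⟨k, j, hk, hj, hj', rfl⟩
      · exact Or.inl h1
      · exact Or.inr ⟨k + 1, j, by omega, by omega, hj, hj', rfl⟩
  · rintro (rfl | rfl | ⟨k, j, hk, hks, hj, hj', rfl⟩)
    · refine ⟨hd, fun v hv hvw => ?_⟩
      rw [Nat.mul_mod_left]
      rcases Nat.eq_zero_or_pos (m * v % w) with h | h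
      · have := hdvd v hv h
        omega
      · exact h
    · exact ⟨le_rfl, fun v h1 h2 => by omega⟩
    · obtain ⟨k, rfl⟩ : ∃ n, k = n + 1 := ⟨k - 1, by omega⟩
      obtain ⟨j, rfl⟩ : ∃ n, j = n + 1 := ⟨j - 1, by omega⟩
      exact hA.isResRecord_stepDen hα hm hmd (by omega)
        (hA.mul_cfErr_le hα hm hmd (by omega) hj')

theorem IsResRecord.res_le (hmd : m < d) {v : ℕ} (hv : IsResRecord m d v) :
    m * v % d ≤ m := by
  rcases Nat.lt_or_ge 1 v with h | h
  · have := hv.2 1 le_rfl h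
    rw [mul_one, Nat.mod_eq_of_lt hmd] at this
    exact this.le
  · have := hv.1
    obtain rfl : v = 1 := by omega
    rw [mul_one, Nat.mod_eq_of_lt hmd]

end Lists

/-! ### Position of `x₀ + b - 1` among the residues -/

section Cases

variable {a b m d r : ℕ} {A : ℕ → ℕ} {α : ℚ}

/-- The segment of the polygon found by the numeration lies strictly before the last one. -/
theorem IsNumerationNat.segment_lt (hA : IsCFE α r A) (hα : α = (m : ℚ) / d) (hm : 1 ≤ m)
    (hmd : m < d) (ha : 0 < a) (hb : 0 < b) (hdvd : d ∣ a * m + b)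
    (hdS : d ∉ AddSubmonoid.closure ({a, b} : Set ℕ)) {N : ℕ → ℕ} {s : ℕ}
    (hN : IsNumerationNat r A (a - 1) N) (hs : IsLastNonzero N s) {x₀ : ℤ}
    (hx₀ : (x₀ : ℚ) = xZero d α A N s) {T B : ℕ} (hT : 2 * T + 2 ≤ r) (hB : 1 ≤ B)
    (hlt : x₀ + b - 1 < stepErr m d A T B + cfErr m d A (2 * T + 1)) : 2 * T + 2 < s := by
  obtain ⟨K, J, hK, hJ, hVa, hx, -, hcase⟩ := hN.exists_min_res hA hα hm hmd ha hs
  have hsr := hN.1.le_length hs.1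
  rw [← hx] at hx₀
  have hx' : x₀ = stepErr m d A K J := by exact_mod_cast hx₀
  have hD := hA.cfErr_pos hα hm hmd (show 2 * T + 1 ≤ r by omega)
  have hb' : (1 : ℤ) ≤ b := by exact_mod_cast hb
  have hupper : x₀ + b - 1 < cfErr m d A (2 * T) := by
    have : (1 : ℤ) ≤ B := by exact_mod_cast hB
    simp only [stepErr] at hlt
    nlinarith
  by_contra! hcon
  rcases hcase with ⟨hsK, hJN⟩ | ⟨hsK, hJ0⟩
  · have hJA : J ≤ A (2 * K + 2) := by
      rw [hJN, hsK]; exact hN.1.le _ (by omega) (by omega)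
    -- On the same segment, `x₀ = dδ_{2T} - J dδ_{2T+1}` turns the upper bound into `b ≤ J
    -- dδ_{2T+1}`, which puts `d` in `⟨a, b⟩`. On an earlier segment, `x₀` itself would be too
    -- large.
    rcases eq_or_lt_of_le (show K ≤ T by omega) with rfl | hKT
    · subst hsK
      obtain ⟨h1, h2⟩ := hN.even_bounds hA ha hs
      rw [← hJN] at h1 h2
      refine hdS (mem_closure_of_last_segment hA hα hm hmd hb hdvd hT hJA h1 h2 ?_)
      rw [hx'] at hupper
      simp only [stepErr] at hupper
      linarith
    · have h1 := hA.cfErr_antitone hα hm hmd (show 2 * (K + 1) ≤ 2 * T by omega) (by omega)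
      have h2 := stepErr_antitone hA hα hm hmd (show 2 * K + 1 ≤ r by omega) hJA
      rw [stepErr_last] at h2
      linarith
  · have h1 := hA.cfErr_antitone hα hm hmd (show 2 * K ≤ 2 * T by omega) (by omega)
    rw [hJ0, stepErr_zero] at hx'
    linarith

/-- Among the intermediate denominators, those with residue at most `x` form a final segment. -/
theorem IsCFE.res_le_iff (hA : IsCFE α r A) (hα : α = (m : ℚ) / d) (hm : 1 ≤ m)
    (hmd : m < d) {T B k j : ℕ} {x : ℤ} (hT : 2 * T + 2 ≤ r) (hB : 1 ≤ B)
    (hBA : B ≤ A (2 * T + 2)) (hlow : stepErr m d A T B ≤ x)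
    (hupp : x < stepErr m d A T B + cfErr m d A (2 * T + 1))
    (hk : 2 * k + 2 ≤ r) (hjA : j ≤ A (2 * k + 2)) :
    ((m * stepDen A k j % d : ℕ) : ℤ) ≤ x ↔ T < k ∨ (k = T ∧ B ≤ j) := by
  rw [hA.res_stepDen hα hm hmd (by omega) (hA.mul_cfErr_le hα hm hmd (by omega) hjA)]
  have hD := hA.cfErr_pos hα hm hmd (show 2 * T + 1 ≤ r by omega)
  rcases lt_trichotomy k T with h | rfl | h
  · refine iff_of_false ?_ (by omega)
    have h1 := stepErr_antitone hA hα hm hmd (show 2 * k + 1 ≤ r by omega) hjA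
    have h2 := hA.cfErr_antitone hα hm hmd (show 2 * (k + 1) ≤ 2 * T by omega) (by omega)
    rw [stepErr_last] at h1
    by_contra! hcon
    have h3 : (1 : ℤ) ≤ B := by exact_mod_cast hB
    simp only [stepErr] at hupp hcon h1
    nlinarith
  · simp only [lt_irrefl, true_and, false_or]
    constructor
    · intro h1
      by_contra! hcon
      have h3 : (j : ℤ) + 1 ≤ B := by exact_mod_cast hcon
      simp only [stepErr] at h1 hupp
      nlinarith
    · exact fun h1 => (stepErr_antitone hA hα hm hmd (by omega) h1).trans hlow
  · refine iff_of_true ?_ (Or.inl h)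
    have h1 := stepErr_antitone hA hα hm hmd (show 2 * T + 1 ≤ r by omega) hBA
    have h2 := hA.cfErr_antitone hα hm hmd (show 2 * (T + 1) ≤ 2 * k by omega) (by omega)
    have h3 := stepErr_antitone hA hα hm hmd (show 2 * k + 1 ≤ r by omega) (Nat.zero_le j)
    rw [stepErr_last] at h1
    rw [stepErr_zero] at h3
    linarith

end Cases

/-! ### Assembly of the four cases -/

theorem theorem5 (a b d : ℕ) (ha : 0 < a) (hb : 0 < b) (hd : 0 < d)
    (hab : Nat.Coprime a b) (had : Nat.Coprime a d) (hbd : Nat.Coprime b d)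
    (hdS : d ∉ AddSubmonoid.closure ({a, b} : Set ℕ))
    (m : ℕ) (hm₁ : 1 ≤ m) (hmd : m < d) (hm : d ∣ a * m + b)
    (α : ℚ) (hα : α = (m : ℚ) / (d : ℚ))
    (r : ℕ) (A : ℕ → ℕ) (hA : IsCFE α r A)
    (τ : ℕ) (hτ : τ = (a * m + b) / d)
    (μ : ℕ → ℤ) (hμ : ∀ i, μ i = (τ : ℤ) * (cfQ A i : ℤ) - (a : ℤ) * (cfP A i : ℤ))
    (S' : AddSubmonoid ℕ)
    (hS' : S' = semigroupQuot (AddSubmonoid.closure ({a, b} : Set ℕ)) d) :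
    -- Case `d < a < b`
    (d < a → a < b →
      embDim S' = 3 + ∑ k ∈ Finset.Icc 1 (r / 2), A (2 * k) ∧
      IrrListedBy S' ({(a : ℤ), (b : ℤ), (τ : ℤ)} +
        muFamily μ 1 (r / 2) (fun _ => 1) (fun k => A (2 * k)))) ∧
    -- The other cases, where `N` is the numeration of `a - 1`
    (∀ (N : ℕ → ℕ) (s : ℕ), IsNumerationNat r A (a - 1) N → IsLastNonzero N s →
      ∀ x₀ : ℚ, x₀ = xZero d α A N s →
      -- Case `a < d < b`, or `a < b < d` and `x₀ + b > d`
      ((a < d ∧ d < b) ∨ (a < b ∧ b < d ∧ (d : ℚ) < x₀ + b) →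
        embDim S' = 2 + ∑ k ∈ Finset.Icc 1 ((s - 1) / 2), A (2 * k) + nuTerm N s ∧
        IrrListedBy S' ({(a : ℤ), (τ : ℤ)} +
          muFamily μ 1 (s / 2) (fun _ => 1) (aPrime A N s))) ∧
      -- Case `a < b < d` and `m < x₀ + b ≤ d`
      (a < b → b < d → (m : ℚ) < x₀ + b → x₀ + b ≤ (d : ℚ) →
        a ∉ semigroupIrr S' ∧
        embDim S' = 1 + ∑ k ∈ Finset.Icc 1 ((s - 1) / 2), A (2 * k) + nuTerm N s ∧
        IrrListedBy S' ({(τ : ℤ)} +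
          muFamily μ 1 (s / 2) (fun _ => 1) (aPrime A N s))) ∧
      -- Case `a < b < d` and `x₀ + b ≤ m`
      (a < b → b < d → x₀ + b ≤ (m : ℚ) →
        ∀ (B : ℕ → ℕ) (s' : ℕ),
          IsNumerationRat α r A ((x₀ + b - 1) / (d : ℚ)) B → IsLastNonzero B s' →
          ∀ t : ℕ, t = tIndex B s' →
          ((∀ i, 0 < i → B (2 * i + 1) = 0) → Even s') ∧
          a ∉ semigroupIrr S' ∧
          (embDim S' : ℤ) = 1 + (A (2 * t) : ℤ) - (B (2 * t) : ℤ) +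
            ∑ k ∈ Finset.Icc (t + 1) ((s - 1) / 2), (A (2 * k) : ℤ) + (nuTerm N s : ℤ) ∧
          IrrListedBy S' (muFamily μ t (s / 2)
            (fun k => if k = t then B (2 * t) else 1) (aPrime A N s)))) := by
  subst hS' hτ
  have hcop : Nat.Coprime m d := by
    rw [Nat.coprime_iff_gcd_eq_one]
    refine Nat.eq_one_of_dvd_coprimes hbd ?_ (Nat.gcd_dvd_right m d)
    exact (Nat.dvd_add_right ((Nat.gcd_dvd_left m d).mul_left a)).1
      ((Nat.gcd_dvd_right m d).trans hm)
  refine ⟨fun hda hab' => ?_, fun N s hN hs x₀ hx₀ => ?_⟩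
  · have hval : ∀ k, 1 ≤ k → k ≤ r / 2 → 1 ≤ k ∧ 2 * k ≤ r ∧ A (2 * k) ≤ A (2 * k) :=
      fun k h1 h2 => ⟨h1, by omega, le_rfl⟩
    -- As `d < a`, the minimum residue is `0`, attained at `d`, whose value is `b`.
    have hirr := semigroupIrr_quot_eq (V := d) (x₀ := 0) hb hd hab had hm hd hda
      (Nat.mul_mod_left _ _) (fun _ _ _ => Nat.zero_le _)
    have hrec := hA.isResRecord_iff hα hm₁ hmd hcop
    have hd_notMem : d ∉ denFamily A 1 (r / 2) (fun _ => 1) (fun k => A (2 * k)) := by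
      rw [mem_denFamily]
      rintro ⟨k, j, h1, h2, h3, h4, h5⟩
      obtain ⟨k, rfl⟩ : ∃ n, k = n + 1 := ⟨k - 1, by omega⟩
      rw [Nat.add_sub_cancel] at h5
      have h6 := hA.res_stepDen hα hm₁ hmd (show 2 * k ≤ r by omega)
        (hA.mul_cfErr_le hα hm₁ hmd (show 2 * k + 2 ≤ r + 1 by omega) h4)
      have h7 := stepErr_antitone hA hα hm₁ hmd (show 2 * k + 1 ≤ r by omega) h4
      have h8 := hA.cfErr_pos hα hm₁ hmd (show 2 * (k + 1) ≤ r by omega)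
      rw [show 2 * (k + 1) = 2 * k + 2 by ring] at h7
      rw [stepErr_last] at h7
      rw [← h5, Nat.mul_mod_left] at h6
      push_cast at h6
      linarith
    have hlist : IrrListedBy (semigroupQuot (AddSubmonoid.closure ({a, b} : Set ℕ)) d)
        ({(a : ℤ), (b : ℤ), (((a * m + b) / d : ℕ) : ℤ)} +
        muFamily μ 1 (r / 2) (fun _ => 1) (fun k => A (2 * k))) := by
      have heq : ({(a : ℤ), (b : ℤ), (((a * m + b) / d : ℕ) : ℤ)} : Multiset ℤ) +
          muFamily μ 1 (r / 2) (fun _ => 1) (fun k => A (2 * k)) =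
          (a : ℤ) ::ₘ ((d ::ₘ 1 ::ₘ
            denFamily A 1 (r / 2) (fun _ => 1) (fun k => A (2 * k))).map
              fun v => (resVal a b d m v : ℤ)) := by
        rw [muFamily_eq_map hA hα hm₁ hmd hm hμ hval, Multiset.map_cons, Multiset.map_cons,
          resVal_one hmd, resVal_self hd]
        simp only [Multiset.insert_eq_cons, Multiset.cons_add, Multiset.singleton_add]
      rw [heq]
      refine irrListedBy_cons_map hab hm ?_ ?_ ?_
      · rw [Multiset.nodup_cons, Multiset.nodup_cons, Multiset.mem_cons]
        exact ⟨not_or.2 ⟨by omega, hd_notMem⟩, one_notMem_denFamily hA (fun _ _ _ => le_rfl) hval,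
          nodup_denFamily hA (fun _ _ _ => le_rfl) hval⟩
      · intro v hv
        have h1 : IsResRecord m d v := by
          rw [hrec]
          simpa only [Multiset.mem_cons, mem_denFamily] using hv
        refine ⟨h1.1, lt_of_le_of_lt ?_ hda⟩
        by_contra! hcon
        have := h1.2 d hd hcon
        simp at this
      · intro x
        rw [hirr]
        simp only [Set.mem_ofPred_eq, zero_add]
        constructor
        · rintro (⟨rfl, -⟩ | ⟨v, h1, -, -, rfl⟩)
          · exact Or.inl rfl
          · refine Or.inr ⟨v, ?_, rfl⟩
            rw [hrec] at h1
            simpa only [Multiset.mem_cons, mem_denFamily] using h1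
        · rintro (rfl | ⟨v, hv, rfl⟩)
          · exact Or.inl ⟨rfl, by omega⟩
          · have h1 : IsResRecord m d v := by
              rw [hrec]
              simpa only [Multiset.mem_cons, mem_denFamily] using hv
            refine Or.inr ⟨v, h1, lt_of_le_of_lt ?_ hda, ?_, rfl⟩
            · by_contra! hcon
              have := h1.2 d hd hcon
              simp at this
            · have := h1.res_le hmd
              omega
    refine ⟨?_, hlist⟩
    rw [hlist.embDim_eq, muFamily_eq_map hA hα hm₁ hmd hm hμ hval, Multiset.card_add,
      Multiset.card_map, card_denFamily]
    simp
  · obtain ⟨K, J, hK, hJ, hVa, hx, hmin, -⟩ := hN.exists_min_res hA hα hm₁ hmd ha hs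
    have hV1 := hA.stepDen_pos hK J
    have hres := hA.res_stepDen hα hm₁ hmd hK hJ
    rw [← hres] at hx hmin
    generalize hX : m * stepDen A K J % d = X at hx hmin
    have hxX : x₀ = (X : ℚ) := by rw [hx₀, ← hx]; norm_num
    have hirr := semigroupIrr_quot_eq hb hd hab had hm hV1 hVa hX
      (fun w h1 h2 => by exact_mod_cast hmin w h1 h2)
    have hrec := hN.isResRecord_lt_iff hA hα hm₁ hmd ha hs
    have hs1 := hs.one_le hN.1.zero
    have hval : ∀ k, 1 ≤ k → k ≤ s / 2 → 1 ≤ k ∧ 2 * k ≤ r ∧ aPrime A N s k ≤ A (2 * k) :=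
      fun k h1 h2 => ⟨h1, aPrime_le hN.1 hs.1 h1 h2⟩
    have hmem : ∀ v, v ∈ 1 ::ₘ denFamily A 1 (s / 2) (fun _ => 1) (aPrime A N s) ↔
        IsResRecord m d v ∧ v < a := by
      intro v
      rw [hrec, Multiset.mem_cons, mem_denFamily]
    have hnodup : (1 ::ₘ denFamily A 1 (s / 2) (fun _ => 1) (aPrime A N s)).Nodup :=
      Multiset.nodup_cons.2 ⟨one_notMem_denFamily hA (fun _ _ _ => le_rfl) hval,
        nodup_denFamily hA (fun _ _ _ => le_rfl) hval⟩
    have hsum := sum_aPrime (A := A) (N := N) (k₀ := 1) hs1 (fun ⟨c, hc⟩ => by omega)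
    have ha_notMem : ¬ d < X + b →
        a ∉ semigroupIrr (semigroupQuot (AddSubmonoid.closure ({a, b} : Set ℕ)) d) := by
      intro h
      rw [hirr]
      rintro (⟨-, h1⟩ | ⟨v, h1, h2, -, h3⟩)
      · exact h h1
      · exact resVal_ne_left hab hm h1.1 h2 h3.symm
    refine ⟨fun hcase => ?_, fun hab' hbd' hmx hxd => ?_, fun hab' hbd' hxm B s' hB hs' t ht => ?_⟩
    · have hdX : d < X + b := by
        rcases hcase with h | ⟨-, -, h⟩
        · omega
        · rw [hxX] at h
          exact_mod_cast h
      have hlist : IrrListedBy (semigroupQuot (AddSubmonoid.closure ({a, b} : Set ℕ)) d)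
          ({(a : ℤ), (((a * m + b) / d : ℕ) : ℤ)} +
            muFamily μ 1 (s / 2) (fun _ => 1) (aPrime A N s)) := by
        have heq : ({(a : ℤ), (((a * m + b) / d : ℕ) : ℤ)} : Multiset ℤ) +
            muFamily μ 1 (s / 2) (fun _ => 1) (aPrime A N s) =
            (a : ℤ) ::ₘ ((1 ::ₘ denFamily A 1 (s / 2) (fun _ => 1) (aPrime A N s)).map
                fun v => (resVal a b d m v : ℤ)) := by
          rw [muFamily_eq_map hA hα hm₁ hmd hm hμ hval, Multiset.map_cons, resVal_one hmd]
          simp only [Multiset.insert_eq_cons, Multiset.cons_add, Multiset.singleton_add]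
        rw [heq]
        refine irrListedBy_cons_map hab hm hnodup (fun v hv => ?_) fun x => ?_
        · have := (hmem v).1 hv
          exact ⟨this.1.1, this.2⟩
        · simp only [hirr, Set.mem_ofPred_eq, hmem]
          constructor
          · rintro (⟨rfl, -⟩ | ⟨v, h1, h2, -, rfl⟩)
            · exact Or.inl rfl
            · exact Or.inr ⟨v, ⟨h1, h2⟩, rfl⟩
          · rintro (rfl | ⟨v, ⟨h1, h2⟩, rfl⟩)
            · exact Or.inl ⟨rfl, hdX⟩
            · exact Or.inr ⟨v, h1, h2, (Nat.mod_lt _ hd).trans hdX, rfl⟩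
      refine ⟨?_, hlist⟩
      rw [hlist.embDim_eq, muFamily_eq_map hA hα hm₁ hmd hm hμ hval, Multiset.card_add,
        Multiset.card_map, card_denFamily]
      simp only [Nat.add_sub_cancel, hsum]
      simp [add_assoc]
    · have hXd : ¬ d < X + b := by
        rw [hxX] at hxd
        exact not_lt.2 (by exact_mod_cast hxd)
      have hmX : m < X + b := by
        rw [hxX] at hmx
        exact_mod_cast hmx
      have hlist : IrrListedBy (semigroupQuot (AddSubmonoid.closure ({a, b} : Set ℕ)) d)
          ({(((a * m + b) / d : ℕ) : ℤ)} +
            muFamily μ 1 (s / 2) (fun _ => 1) (aPrime A N s)) := by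
        have heq : ({(((a * m + b) / d : ℕ) : ℤ)} : Multiset ℤ) +
            muFamily μ 1 (s / 2) (fun _ => 1) (aPrime A N s) =
            (1 ::ₘ denFamily A 1 (s / 2) (fun _ => 1) (aPrime A N s)).map
                fun v => (resVal a b d m v : ℤ) := by
          rw [muFamily_eq_map hA hα hm₁ hmd hm hμ hval, Multiset.map_cons, resVal_one hmd,
            Multiset.singleton_add]
        rw [heq]
        refine irrListedBy_map hab hm hnodup (fun v hv => ((hmem v).1 hv).2) fun x => ?_
        simp only [hirr, Set.mem_ofPred_eq, hmem]
        constructor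
        · rintro (⟨-, h⟩ | ⟨v, h1, h2, -, rfl⟩)
          · exact absurd h hXd
          · exact ⟨v, ⟨h1, h2⟩, rfl⟩
        · rintro ⟨v, ⟨h1, h2⟩, rfl⟩
          exact Or.inr ⟨v, h1, h2, (h1.res_le hmd).trans_lt hmX, rfl⟩
      refine ⟨ha_notMem hXd, ?_, hlist⟩
      rw [hlist.embDim_eq, muFamily_eq_map hA hα hm₁ hmd hm hμ hval, Multiset.card_add,
        Multiset.card_map, card_denFamily]
      simp only [Nat.add_sub_cancel, hsum]
      simp [add_assoc]
    · have hXm : X + b ≤ m := by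
        rw [hxX] at hxm
        exact_mod_cast hxm
      have hXd : ¬ d < X + b := by omega
      -- For integer residues, being below `x₀ + b` means being at most `d β = x₀ + b - 1`.
      have halt : altDigitSum m d A B r = (X : ℤ) + b - 1 := by
        have h1 := hB.altDigitSum_eq hd hα
        have h2 : (d : ℚ) ≠ 0 := by exact_mod_cast hd.ne'
        rw [hxX, mul_div_cancel₀ _ h2] at h1
        exact_mod_cast h1
      obtain ⟨heven, T, htT, hTr, hBT, hlow, hupp⟩ :=
        hB.1.tIndex_spec hA hα hm₁ hmd hs' (by rw [halt]; omega)
      rw [halt] at hlow hupp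
      have hBA := hB.1.le (2 * T + 2) (by omega) hTr
      -- Thus `2t < s`: the segment `t` is complete, with upper limit `A (2 * t)` rather than `N s`,
      -- as the count requires.
      have hTs := hN.segment_lt hA hα hm₁ hmd ha hb hm hdS hs (x₀ := X)
        (by rw [← hx₀, hxX]; norm_num) hTr hBT hupp
      obtain rfl : t = T + 1 := ht.trans htT
      rw [show 2 * (T + 1) = 2 * T + 2 by ring]
      set lo : ℕ → ℕ := fun k => if k = T + 1 then B (2 * T + 2) else 1 with hlo
      have hlo1 : ∀ k, T + 1 ≤ k → k ≤ s / 2 → 1 ≤ lo k := by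
        intro k _ _
        simp only [hlo]
        split_ifs
        · exact hBT
        · exact le_rfl
      have hval' : ∀ k, T + 1 ≤ k → k ≤ s / 2 →
          1 ≤ k ∧ 2 * k ≤ r ∧ aPrime A N s k ≤ A (2 * k) :=
        fun k h1 h2 => hval k (by omega) h2
      have hmem' : ∀ v, v ∈ denFamily A (T + 1) (s / 2) lo (aPrime A N s) ↔
          IsResRecord m d v ∧ v < a ∧ m * v % d < X + b := by
        intro v
        rw [← and_assoc, hrec, mem_denFamily]
        have hiff : ∀ k j, 1 ≤ k → k ≤ s / 2 → 1 ≤ j → j ≤ aPrime A N s k →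
            (m * stepDen A (k - 1) j % d < X + b ↔
              T < k - 1 ∨ (k - 1 = T ∧ B (2 * T + 2) ≤ j)) := by
          intro k j h1 h2 h3 h4
          obtain ⟨-, h5, h6⟩ := hval k h1 h2
          obtain ⟨k, rfl⟩ : ∃ n, k = n + 1 := ⟨k - 1, by omega⟩
          rw [Nat.add_sub_cancel, ← hA.res_le_iff hα hm₁ hmd hTr hBT hBA hlow hupp
            (k := k) (by omega) (h4.trans h6)]
          omega
        constructor
        · rintro ⟨k, j, h1, h2, h3, h4, rfl⟩
          have h5 := hlo1 k h1 h2
          refine ⟨Or.inr ⟨k, j, by omega, h2, by omega, h4, rfl⟩, ?_⟩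
          rw [hiff k j (by omega) h2 (by omega) h4]
          simp only [hlo] at h3
          split_ifs at h3 with h6
          · exact Or.inr ⟨by omega, h3⟩
          · exact Or.inl (by omega)
        · rintro ⟨rfl | ⟨k, j, h1, h2, h3, h4, rfl⟩, hlt⟩
          · rw [mul_one, Nat.mod_eq_of_lt hmd] at hlt
            omega
          · rw [hiff k j h1 h2 h3 h4] at hlt
            refine ⟨k, j, by omega, h2, ?_, h4, rfl⟩
            simp only [hlo]
            split_ifs with h6
            · rcases hlt with h | h
              · omega
              · exact h.2
            · exact h3
      have hlist : IrrListedBy (semigroupQuot (AddSubmonoid.closure ({a, b} : Set ℕ)) d)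
          (muFamily μ (T + 1) (s / 2) lo (aPrime A N s)) := by
        rw [muFamily_eq_map hA hα hm₁ hmd hm hμ hval']
        refine irrListedBy_map hab hm (nodup_denFamily hA hlo1 hval')
          (fun v hv => ((hmem' v).1 hv).2.1) fun x => ?_
        simp only [hirr, Set.mem_ofPred_eq, hmem']
        constructor
        · rintro (⟨-, h⟩ | ⟨v, h1, h2, h3, rfl⟩)
          · exact absurd h hXd
          · exact ⟨v, ⟨h1, h2, h3⟩, rfl⟩
        · rintro ⟨v, ⟨h1, h2, h3⟩, rfl⟩
          exact Or.inr ⟨v, h1, h2, h3, rfl⟩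
      refine ⟨heven, ha_notMem hXd, ?_, hlist⟩
      have hsum' := sum_aPrime (A := A) (N := N) (k₀ := T + 1 + 1) hs1
        (fun ⟨c, hc⟩ => by omega)
      have hcard : (denFamily A (T + 1) (s / 2) lo (aPrime A N s)).card =
          (A (2 * T + 2) + 1 - B (2 * T + 2)) +
            (∑ k ∈ Finset.Icc (T + 1 + 1) ((s - 1) / 2), A (2 * k) + nuTerm N s) := by
        rw [card_denFamily, ← hsum',
          ← Finset.add_sum_Ioc_eq_sum_Icc (show T + 1 ≤ s / 2 by omega)]
        congr 1
        · rw [aPrime, if_pos (by omega), hlo]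
          simp [mul_add]
        · refine Finset.sum_congr (by ext; simp) fun k hk => ?_
          have : k ≠ T + 1 := by
            rw [Finset.mem_Icc] at hk
            omega
          simp [hlo, this]
      rw [hlist.embDim_eq, muFamily_eq_map hA hα hm₁ hmd hm hμ hval', Multiset.card_map, hcard]
      push_cast [Nat.cast_sub (show B (2 * T + 2) ≤ A (2 * T + 2) + 1 by omega)]
      ring
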